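/- Fix $\omega_1\in\mathbb C\setminus\{0\}$. For $\beta\in\mathbb C$ put $\omega_3=\pi i\beta/(2\omega_1)$, so that $\beta=2\omega_1\omega_3/(\pi i)$, and $\tau=\omega_3/\omega_1$; only $\beta$ with $\operatorname{Im}\tau>0$ are considered. Let $\omega_0=0$, $\omega_2=-\omega_1-\omega_3$, let $\wp$ and $\zeta$ be the Weierstrass functions with periods $2\omega_1,2\omega_3$, let $e_\nu=\wp(\omega_\nu)$ ($\nu=1,2,3$) and $\eta_1=\zeta(\omega_1)$. With $R=2\omega_1/\pi$ let $$\theta_1(x)=2\sum_{n\ge0}(-1)^n e^{\pi i\tau(n+1/2)^2}\sin\tfrac{(2n+1)x}{R},\qquad \theta_2(x)=2\sum_{n\ge0}e^{\pi i\tau(n+1/2)^2}\cos\tfrac{(2n+1)x}{R},$$ $$\theta_3(x)=1+2\sum_{n\ge1}e^{\pi i\tau n^2}\cos\tfrac{2nx}{R},\qquad \theta_4(x)=1+2\sum_{n\ge1}(-1)^{n}e^{\pi i\tau n^2}\cos\tfrac{2nx}{R}.$$ Let $N$ be a positive integer, let $g_0,g_1,g_2,g_3,\lambda\in\mathbb C$,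 and put $|g|=g_0+g_1+g_2+g_3$ and $c_0=(g_0g_1+g_2g_3)e_1+(g_0g_2+g_1g_3)e_2+(g_0g_3+g_1g_2)e_3$. Let $$H_N=\sum_{j=1}^N\Bigl(-\frac{\partial^2}{\partial x_j^2}+\sum_{\nu=0}^3g_\nu(g_\nu-1)\wp(x_j+\omega_\nu)\Bigr)+\sum_{1\le j<k\le N}2\lambda(\lambda-1)\{\wp(x_j-x_k)+\wp(x_j+x_k)\}$$ be the Inozemtsev Hamiltonian, and $$\Psi_N(x)=\Bigl(\prod_{j=1}^N\prod_{\nu=0}^3\theta_{\nu+1}(x_j)^{g_\nu}\Bigr)\prod_{1\le j<k\le N}\theta_1(x_j-x_k)^\lambda\,\theta_1(x_j+x_k)^\lambda .$$ Then, on every open set of points $(x,\beta)\in\mathbb C^N\times\mathbb C$ with $\operatorname{Im}\tau>0$ on which the theta factors of $\Psi_N$ have no zeros and continuous logarithms of them are chosen (the powers being formed with these logarithms), $\Psi_N$ is a holomorphic function of $(x,\beta)$ and $$\Bigl\{A_N\frac{\partial}{\partial\beta}+H_N-C_N\Bigr\}\Psi_N(x)=0,$$ where $\partial/\partial\beta$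 is taken at fixed $x$ and fixed $\omega_1$, and $$A_N=4\lambda(N-1)+2|g|,\qquad C_N=\frac{A_N}{2}\,N\,[1-\lambda(N-1)-|g|]\,\frac{\eta_1}{\omega_1}+Nc_0 .$$ -/

import Mathlib

open scoped Real

noncomputable section

namespace Inozemtsev

/-- The modulus `τ = ω₃ / ω₁`, as a function of `β = 2 ω₁ ω₃ / (π i)` with `ω₁` fixed. -/
def tau (ω₁ β : ℂ) : ℂ := π * Complex.I * β / (2 * ω₁ ^ 2)

/-- The half-period `ω₃`, as a function of `β = 2 ω₁ ω₃ / (π i)` with `ω₁` fixed. -/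
def omega3 (ω₁ β : ℂ) : ℂ := π * Complex.I * β / (2 * ω₁)

/-- For `Im τ > 0` the full periods `2 ω₁`, `2 ω₃` are linearly independent over `ℝ`. -/
theorem linearIndependent_periods {ω₁ β : ℂ} (h : 0 < (tau ω₁ β).im) :
    LinearIndependent ℝ ![2 * ω₁, 2 * omega3 ω₁ β] := by
  have hω : ω₁ ≠ 0 := by
    rintro rfl
    simp [tau] at h
  have e : omega3 ω₁ β = tau ω₁ β * ω₁ := by
    unfold tau omega3
    field_simp
  rw [LinearIndependent.pair_iff]
  intro s t hst
  rw [e, Complex.real_smul, Complex.real_smul] at hst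
  have h1 : (2 * ω₁) * ((s : ℂ) + t * tau ω₁ β) = 0 := by linear_combination hst
  have h2 : (s : ℂ) + t * tau ω₁ β = 0 :=
    (mul_eq_zero.mp h1).resolve_left (mul_ne_zero two_ne_zero hω)
  have him := congrArg Complex.im h2
  have hre := congrArg Complex.re h2
  simp at him hre
  have ht : t = 0 := him.resolve_right h.ne'
  subst ht
  simpa using hre

/-- The pair of periods `(2 ω₁, 2 ω₃)`. -/
def periods (ω₁ β : ℂ) (h : 0 < (tau ω₁ β).im) : PeriodPair where
  ω₁ := 2 * ω₁
  ω₂ := 2 * omega3 ω₁ β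
  indep := linearIndependent_periods h

/-- The half-periods `ω₀ = 0`, `ω₁`, `ω₂ = -ω₁ - ω₃`, `ω₃` of the lattice with
periods `(2 ω₁, 2 ω₃)`. -/
def halfPeriod (L : PeriodPair) : Fin 4 → ℂ :=
  ![0, L.ω₁ / 2, -(L.ω₁ / 2) - L.ω₂ / 2, L.ω₂ / 2]

/-- The Weierstrass zeta function `1/x + ∑_{Ω ≠ 0} (1/(x - Ω) + 1/Ω + x/Ω²)`. As `1 / 0 = 0`, the
summand at the lattice point `0` is the term `1/x`. -/
def weierstrassZeta (L : PeriodPair) (x : ℂ) : ℂ :=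
  ∑' l : L.lattice, (1 / (x - l) + 1 / (l : ℂ) + x / (l : ℂ) ^ 2)

/-- `e_ν = ℘(ω_ν)`. -/
def eConst (L : PeriodPair) (ν : Fin 4) : ℂ := L.weierstrassP (halfPeriod L ν)

/-- `η₁ = ζ(ω₁)`. -/
def eta1 (L : PeriodPair) : ℂ := weierstrassZeta L (halfPeriod L 1)

/-- The theta functions: `theta ω₁ τ ν x` is `θ_{ν+1}(x) = ϑ_{ν+1}(x / R, q)`, where `R = 2 ω₁ / π`
and `q = exp (π i τ)`. -/
def theta (ω₁ τ : ℂ) (ν : Fin 4) (x : ℂ) : ℂ :=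
  let z : ℂ := x / (2 * ω₁ / π)
  match ν with
  | 0 => 2 * ∑' n : ℕ, (-1) ^ n * Complex.exp (τ * π * Complex.I * ((n : ℂ) + 1 / 2) ^ 2) *
      Complex.sin ((2 * n + 1) * z)
  | 1 => 2 * ∑' n : ℕ, Complex.exp (τ * π * Complex.I * ((n : ℂ) + 1 / 2) ^ 2) *
      Complex.cos ((2 * n + 1) * z)
  | 2 => 1 + 2 * ∑' n : ℕ, Complex.exp (τ * π * Complex.I * ((n : ℂ) + 1) ^ 2) *
      Complex.cos (2 * ((n : ℂ) + 1) * z)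
  | 3 => 1 + 2 * ∑' n : ℕ, (-1) ^ (n + 1) * Complex.exp (τ * π * Complex.I * ((n : ℂ) + 1) ^ 2) *
      Complex.cos (2 * ((n : ℂ) + 1) * z)

/-- `l` is a branch of the logarithm of `F` on `U`: it is continuous there and `exp l = F`.
The corresponding branch of the complex power `F ^ a` is `exp (a l)`. -/
def IsLogBranchOn {X : Type*} [TopologicalSpace X] (F l : X → ℂ) (U : Set X) : Prop :=
  ContinuousOn l U ∧ ∀ p ∈ U, Complex.exp (l p) = F p

/-- The Inozemtsev Hamiltonian `H_N(x; {g_ν}, λ)` for the lattice `L`, applied to the function `f`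
and evaluated at `x`. -/
def hamiltonian (L : PeriodPair) {N : ℕ} (g : Fin 4 → ℂ) (lam : ℂ)
    (f : (Fin N → ℂ) → ℂ) (x : Fin N → ℂ) : ℂ :=
  ∑ j : Fin N, (-iteratedDeriv 2 (fun z : ℂ => f (Function.update x j z)) (x j) +
      (∑ ν : Fin 4, g ν * (g ν - 1) * L.weierstrassP (x j + halfPeriod L ν)) * f x) +
    (∑ j : Fin N, ∑ k ∈ Finset.Ioi j, 2 * lam * (lam - 1) *
      (L.weierstrassP (x j - x k) + L.weierstrassP (x j + x k))) * f x

/-- The function `Ψ_N(x; {g_ν}, λ)` of `(x, β)`,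
`∏_j ∏_ν θ_{ν+1}(x_j)^{g_ν} · ∏_{j<k} θ₁(x_j - x_k)^λ θ₁(x_j + x_k)^λ`,
formed with logarithms `l j ν` of `θ_{ν+1}(x_j)`, `lm j k` of `θ₁(x_j - x_k)` and
`lp j k` of `θ₁(x_j + x_k)`. -/
def Psi {N : ℕ} (g : Fin 4 → ℂ) (lam : ℂ) (l : Fin N → Fin 4 → (Fin N → ℂ) × ℂ → ℂ)
    (lm lp : Fin N → Fin N → (Fin N → ℂ) × ℂ → ℂ) (p : (Fin N → ℂ) × ℂ) : ℂ :=
  (∏ j : Fin N, ∏ ν : Fin 4, Complex.exp (g ν * l j ν p)) *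
    ∏ j : Fin N, ∏ k ∈ Finset.Ioi j,
      (Complex.exp (lam * lm j k p) * Complex.exp (lam * lp j k p))

/-- `|g| = g₀ + g₁ + g₂ + g₃`. -/
def absG (g : Fin 4 → ℂ) : ℂ := g 0 + g 1 + g 2 + g 3

/-- `A_N = 4 λ (N - 1) + 2 |g|`. -/
def constA (N : ℕ) (g : Fin 4 → ℂ) (lam : ℂ) : ℂ := 4 * lam * ((N : ℂ) - 1) + 2 * absG g

/-- `c₀ = (g₀g₁ + g₂g₃) e₁ + (g₀g₂ + g₁g₃) e₂ + (g₀g₃ + g₁g₂) e₃`. -/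
def constc0 (L : PeriodPair) (g : Fin 4 → ℂ) : ℂ :=
  (g 0 * g 1 + g 2 * g 3) * eConst L 1 + (g 0 * g 2 + g 1 * g 3) * eConst L 2 +
    (g 0 * g 3 + g 1 * g 2) * eConst L 3

/-- `C_N = (A_N / 2) N [1 - λ (N - 1) - |g|] η₁ / ω₁ + N c₀`. -/
def constC (L : PeriodPair) (N : ℕ) (g : Fin 4 → ℂ) (lam : ℂ) : ℂ :=
  constA N g lam / 2 * N * (1 - lam * ((N : ℂ) - 1) - absG g) * (eta1 L / halfPeriod L 1) +
    N * constc0 L g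

end Inozemtsev

end

open scoped Real

noncomputable section

namespace Inozemtsev

open Complex Filter Topology

/-! Write `Ψ_N = exp S`, where `S` is a linear combination of logarithms of theta functions. In the
variable `β` each theta function satisfies the heat equation `∂θ/∂β = θ''/2`. With `Λ = θ'/θ`, the
`β`-derivative of `log θ` is therefore `(Λ' + Λ²)/2`. Moreover `Λ' = -℘(· + ω_ν) - η₁/ω₁`. After
division by `Ψ_N` the claim is an identity between values of `℘`, squares of logarithmic
derivatives, and products of different logarithmic derivatives coming from `(∂S/∂x_j)²`.

The products are removed by one relation: for `x + y + z = 0`, the square of `Λ(x) + Λ(y) + Λ(z)`,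
with `Λ` belonging to `θ₁`, is `℘(x) + ℘(y) + ℘(z)`. Half-period shifts carry it over to the other
theta functions. It serves pairs of theta factors in one variable, a variable against a pair, and
triples of variables (`sq_sum_four`, `sum_mul_pair`, `sum_sq_triple`). What remains are squares,
whose coefficients match those of `A_N ∂/∂β` exactly for the given `A_N`; the leftover constants
make up `C_N` (`inozemtsev_identity`).

The relation comes from `θ'(0)² θ(x+y) θ(x-y) = -θ(x)² θ(y)² (℘(x) - ℘(y))`. This holds because
theta functions of order two are determined by two Fourier coefficients, so the left side is a
combination of `θ²` and `℘θ²`. Logarithmic differentiation, twice, together with the differential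
equations of `℘`, gives both the three-term relation and `Λ' = -℘ - κ`. Comparison with the
Weierstrass zeta function at `±ω₁` yields `κ = η₁/ω₁`. -/

/-! ### Heat equation for theta functions with characteristics -/

/-- The `z`-derivative of `jacobiTheta₂'`, in terms of the `τ`-derivative of `jacobiTheta₂`. -/
theorem hasDerivAt_jacobiTheta₂' (z : ℂ) {τ : ℂ} (hτ : 0 < τ.im) :
    HasDerivAt (jacobiTheta₂' · τ) (4 * π * I * jacobiTheta₂_fderiv z τ (0, 1)) z := by
  obtain ⟨S, hz⟩ := exists_gt |z.im|
  -- The bound on the terms is uniform only for bounded imaginary part, so the series is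
  -- differentiated termwise on a horizontal strip.
  let V : Set ℂ := {u | |u.im| < S}
  have hVo : IsOpen V := (_root_.continuous_abs.comp continuous_im).isOpen_preimage _ isOpen_Iio
  have hVp : IsPreconnected V := by
    refine Convex.isPreconnected ?_
    simpa only [V, abs_lt] using! (convex_halfSpace_im_gt _).inter (convex_halfSpace_im_lt _)
  have hs : Summable fun n : ℤ =>
      (2 * π) ^ 2 * (|n| ^ 2 * Real.exp (-π * (τ.im * n ^ 2 - 2 * S * |n|))) :=
    (summable_pow_mul_jacobiTheta₂_term_bound S hτ 2).mul_left _
  have key := hasDerivAt_tsum_of_isPreconnected (t := V) (y := z) (y₀ := z)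
    (g := fun n w => jacobiTheta₂'_term n w τ)
    (g' := fun n w => (2 * π * I * n) * jacobiTheta₂'_term n w τ) hs hVo hVp
    (fun n y _ => by
      have h1 : HasDerivAt (fun w => 2 * π * I * n * w + π * I * n ^ 2 * τ) (2 * π * I * n) y := by
        simpa using ((hasDerivAt_id y).const_mul (2 * π * I * n)).add_const (π * I * n ^ 2 * τ)
      have h2 := (h1.cexp).const_mul (2 * π * I * n)
      refine h2.congr_deriv ?_
      simp only [jacobiTheta₂'_term, jacobiTheta₂_term]
      ring)
    (fun n y hy => by
      rw [norm_mul]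
      have e : ‖(2 * π * I * n : ℂ)‖ = 2 * π * |(n : ℝ)| := by
        simp [abs_of_pos Real.pi_pos]
      rw [e]
      refine (mul_le_mul_of_nonneg_left
        (norm_jacobiTheta₂'_term_le hτ (le_of_lt hy) le_rfl n) (by positivity)).trans (le_of_eq ?_)
      push_cast
      ring)
    hz (hasSum_jacobiTheta₂'_term z hτ).summable hz
  refine key.congr_deriv ?_
  -- The heat equation term by term: `(2πin)² = 4πi · πin²`, and `πin²` is the factor produced by
  -- `∂/∂τ`.
  have h3 := ((ContinuousLinearMap.apply ℂ ℂ ((0, 1) : ℂ × ℂ)).hasSum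
    (hasSum_jacobiTheta₂_term_fderiv z hτ)).mul_left (4 * π * I)
  refine (h3.congr_fun ?_).tsum_eq
  intro n
  simp only [ContinuousLinearMap.apply_apply, jacobiTheta₂_term_fderiv, jacobiTheta₂'_term,
    jacobiTheta₂_term]
  simp
  ring

/-- The theta function with characteristics `a`, `b`. -/
def thetaChar (a b u τ : ℂ) : ℂ :=
  cexp (π * I * a ^ 2 * τ + 2 * π * I * a * (u + b)) * jacobiTheta₂ (u + b + a * τ) τ

/-- The `u`-derivative of `thetaChar`. -/
def thetaChar' (a b u τ : ℂ) : ℂ :=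
  cexp (π * I * a ^ 2 * τ + 2 * π * I * a * (u + b)) *
    (2 * π * I * a * jacobiTheta₂ (u + b + a * τ) τ + jacobiTheta₂' (u + b + a * τ) τ)

/-- The second `u`-derivative of `thetaChar`. -/
def thetaChar'' (a b u τ : ℂ) : ℂ :=
  cexp (π * I * a ^ 2 * τ + 2 * π * I * a * (u + b)) *
    ((2 * π * I * a) ^ 2 * jacobiTheta₂ (u + b + a * τ) τ +
      2 * (2 * π * I * a) * jacobiTheta₂' (u + b + a * τ) τ +
      4 * π * I * jacobiTheta₂_fderiv (u + b + a * τ) τ (0, 1))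

theorem jacobiTheta₂_fderiv_apply_one_zero (z : ℂ) {τ : ℂ} (hτ : 0 < τ.im) :
    jacobiTheta₂_fderiv z τ (1, 0) = jacobiTheta₂' z τ := by
  have step3 : HasDerivAt (fun x ↦ jacobiTheta₂ x τ) ((jacobiTheta₂_fderiv z τ) (1, 0)) z :=
    (((hasFDerivAt_jacobiTheta₂ z hτ).comp z (hasFDerivAt_prodMk_left z τ)).hasDerivAt :)
  exact step3.unique (hasDerivAt_jacobiTheta₂_fst z hτ)

theorem hasDerivAt_exp_char (a b u τ : ℂ) :
    HasDerivAt (fun u => cexp (π * I * a ^ 2 * τ + 2 * π * I * a * (u + b)))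
      (cexp (π * I * a ^ 2 * τ + 2 * π * I * a * (u + b)) * (2 * π * I * a)) u := by
  have : HasDerivAt (fun u => π * I * a ^ 2 * τ + 2 * π * I * a * (u + b)) (2 * π * I * a) u := by
    simpa using (((hasDerivAt_id u).add_const b).const_mul (2 * π * I * a)).const_add
      (π * I * a ^ 2 * τ)
  exact this.cexp

theorem hasDerivAt_thetaChar (a b u : ℂ) {τ : ℂ} (hτ : 0 < τ.im) :
    HasDerivAt (fun u => thetaChar a b u τ) (thetaChar' a b u τ) u := by
  have h2 : HasDerivAt (fun u => u + b + a * τ) 1 u := by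
    simpa using ((hasDerivAt_id u).add_const b).add_const (a * τ)
  have h := (hasDerivAt_exp_char a b u τ).mul
    ((hasDerivAt_jacobiTheta₂_fst (u + b + a * τ) hτ).comp u h2)
  refine h.congr_deriv ?_
  simp only [thetaChar', Function.comp_apply]
  ring

theorem hasDerivAt_thetaChar' (a b u : ℂ) {τ : ℂ} (hτ : 0 < τ.im) :
    HasDerivAt (fun u => thetaChar' a b u τ) (thetaChar'' a b u τ) u := by
  have h2 : HasDerivAt (fun u => u + b + a * τ) 1 u := by
    simpa using ((hasDerivAt_id u).add_const b).add_const (a * τ)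
  have h := (hasDerivAt_exp_char a b u τ).mul
    ((((hasDerivAt_jacobiTheta₂_fst (u + b + a * τ) hτ).comp u h2).const_mul (2 * π * I * a)).add
      ((hasDerivAt_jacobiTheta₂' (u + b + a * τ) hτ).comp u h2))
  refine h.congr_deriv ?_
  simp only [thetaChar'', Function.comp_apply, Pi.add_apply]
  ring

/-- The heat equation, together with the joint differentiability in `u` and `τ`. -/
theorem hasFDerivAt_thetaChar (a b u : ℂ) {τ : ℂ} (hτ : 0 < τ.im) :
    HasFDerivAt (fun p : ℂ × ℂ => thetaChar a b p.1 p.2)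
      (thetaChar' a b u τ • ContinuousLinearMap.fst ℂ ℂ ℂ +
        (thetaChar'' a b u τ / (4 * π * I)) • ContinuousLinearMap.snd ℂ ℂ ℂ) (u, τ) := by
  have f1 : HasFDerivAt (fun p : ℂ × ℂ => p.1) (ContinuousLinearMap.fst ℂ ℂ ℂ) (u, τ) :=
    hasFDerivAt_fst
  have f2 : HasFDerivAt (fun p : ℂ × ℂ => p.2) (ContinuousLinearMap.snd ℂ ℂ ℂ) (u, τ) :=
    hasFDerivAt_snd
  have hE := ((f2.const_mul (π * I * a ^ 2)).add
    ((f1.add_const b).const_mul (2 * π * I * a))).cexp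
  have hJ := (hasFDerivAt_jacobiTheta₂ (u + b + a * τ) hτ).comp (u, τ)
    (((f1.add_const b).add (f2.const_mul a)).prodMk f2)
  refine (hE.mul hJ).congr_fderiv ?_
  have hpi : (π : ℂ) ≠ 0 := by exact_mod_cast Real.pi_ne_zero
  ext
  · simp [thetaChar']
    rw [jacobiTheta₂_fderiv_apply_one_zero _ hτ]
    ring
  -- The argument `u + b + aτ` itself moves with `τ`, so the `τ`-derivative also picks up `a` times
  -- the `z`-derivative.
  · have e : (a, (1 : ℂ)) = a • (1, 0) + (0, 1) := by simp
    simp [thetaChar'']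
    rw [e, map_add, map_smul, jacobiTheta₂_fderiv_apply_one_zero _ hτ]
    simp only [smul_eq_mul]
    field_simp
    ring

/-! ### The four theta functions as theta functions with characteristics -/

/-- The exponential prefactor of `thetaChar` completes the square `n² + 2na` to `(n + a)²`. -/
theorem hasSum_thetaChar (a b u : ℂ) {τ : ℂ} (hτ : 0 < τ.im) :
    HasSum (fun n : ℤ => cexp (π * I * (n + a) ^ 2 * τ + 2 * π * I * (n + a) * (u + b)))
      (thetaChar a b u τ) := by
  refine ((hasSum_jacobiTheta₂_term (u + b + a * τ) hτ).mul_left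
    (cexp (π * I * a ^ 2 * τ + 2 * π * I * a * (u + b)))).congr_fun fun n => ?_
  rw [jacobiTheta₂_term, ← Complex.exp_add]
  congr 1
  ring

/-- The indices `n` and `-n-1` give opposite values of `n + 1/2`; pairing them turns exponentials
into cosines. -/
theorem hasSum_thetaChar_half (b u : ℂ) {τ : ℂ} (hτ : 0 < τ.im) :
    HasSum (fun n : ℕ => 2 * (cexp (τ * π * I * ((n : ℂ) + 1 / 2) ^ 2) *
      Complex.cos ((2 * n + 1) * (π * u) + (2 * n + 1) * (π * b)))) (thetaChar (1 / 2) b u τ) := by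
  refine (hasSum_thetaChar (1 / 2) b u hτ).nat_add_neg_add_one.congr_fun fun n => ?_
  rw [Complex.cos]
  push_cast
  rw [show (π * I * ((n : ℂ) + 1 / 2) ^ 2 * τ + 2 * π * I * (n + 1 / 2) * (u + b)) =
    τ * π * I * ((n : ℂ) + 1 / 2) ^ 2 +
      ((2 * n + 1) * (π * u) + (2 * n + 1) * (π * b)) * I by ring,
    show (π * I * (-((n : ℂ) + 1) + 1 / 2) ^ 2 * τ + 2 * π * I * (-(n + 1) + 1 / 2) * (u + b)) =
    τ * π * I * ((n : ℂ) + 1 / 2) ^ 2 +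
      -((2 * n + 1) * (π * u) + (2 * n + 1) * (π * b)) * I by ring,
    Complex.exp_add, Complex.exp_add]
  ring

theorem hasSum_thetaChar_zero (b u : ℂ) {τ : ℂ} (hτ : 0 < τ.im) :
    HasSum (fun n : ℕ => 2 * (cexp (τ * π * I * ((n : ℂ) + 1) ^ 2) *
      Complex.cos (2 * (n + 1) * (π * u) + 2 * (n + 1) * (π * b)))) (thetaChar 0 b u τ - 1) := by
  have h := (hasSum_nat_add_iff' 1).mpr (hasSum_thetaChar 0 b u hτ).nat_add_neg
  -- Pairing `n` with `-n` counts the term `1` at `n = 0` twice, and the pair `1 + 1` at `n = 0` is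
  -- then split off.
  have e : ∀ s : ℂ, s + 1 - (1 + 1) = s - 1 := fun s => by ring
  simp only [Int.cast_zero, add_zero, mul_zero, zero_mul, Complex.exp_zero, Finset.range_one,
    Finset.sum_singleton, Nat.cast_zero, neg_zero, ne_eq, OfNat.ofNat_ne_zero,
    not_false_eq_true, zero_pow, e] at h
  refine h.congr_fun fun n => ?_
  rw [Complex.cos]
  push_cast
  rw [show (π * I * ((n : ℂ) + 1) ^ 2 * τ + 2 * π * I * (n + 1) * (u + b)) =
    τ * π * I * ((n : ℂ) + 1) ^ 2 +
      (2 * (n + 1) * (π * u) + 2 * (n + 1) * (π * b)) * I by ring,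
    show (π * I * (-((n : ℂ) + 1)) ^ 2 * τ + 2 * π * I * (-(n + 1)) * (u + b)) =
    τ * π * I * ((n : ℂ) + 1) ^ 2 +
      -(2 * (n + 1) * (π * u) + 2 * (n + 1) * (π * b)) * I by ring,
    Complex.exp_add, Complex.exp_add]
  ring

/-- The first characteristic of `θ_{ν+1}`. -/
def charA : Fin 4 → ℂ := ![1 / 2, 1 / 2, 0, 0]

/-- The second characteristic of `θ_{ν+1}`. -/
def charB : Fin 4 → ℂ := ![1 / 2, 0, 0, 1 / 2]

/-- The sign relating `θ_{ν+1}` to the theta function with characteristics. -/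
def charSign : Fin 4 → ℂ := ![-1, 1, 1, 1]

theorem theta_eq (ω₁ : ℂ) {τ : ℂ} (hτ : 0 < τ.im) (ν : Fin 4) (x : ℂ) :
    theta ω₁ τ ν x = charSign ν * thetaChar (charA ν) (charB ν) (x / (2 * ω₁)) τ := by
  have hz : x / (2 * ω₁ / π) = π * (x / (2 * ω₁)) := by rw [div_div_eq_mul_div]; ring
  -- The characteristic `b = 1/2` turns the cosine into a sine with a minus sign, whence `charSign 0
  -- = -1`.
  have hodd : ∀ (n : ℕ) (w : ℂ), Complex.cos (w + (2 * n + 1) * (π * (1 / 2))) =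
      -((-1) ^ n * Complex.sin w) := by
    intro n w
    rw [show w + (2 * n + 1) * (π * (1 / 2)) = (w + π / 2) + n * π by ring,
      Complex.cos_antiperiodic.add_nat_mul_eq, Complex.cos_add_pi_div_two]
    ring
  have heven : ∀ (n : ℕ) (w : ℂ), Complex.cos (w + 2 * (n + 1) * (π * (1 / 2))) =
      (-1) ^ (n + 1) * Complex.cos w := by
    intro n w
    rw [show w + 2 * (n + 1) * (π * (1 / 2)) = w + (n + 1 : ℕ) * π by push_cast; ring,
      Complex.cos_antiperiodic.add_nat_mul_eq]
  fin_cases ν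
  · have h := (hasSum_thetaChar_half (1 / 2) (x / (2 * ω₁)) hτ).tsum_eq
    simp only [theta, charSign, charA, charB, hz]
    simp only [hodd] at h
    rw [tsum_mul_left] at h
    simp
    rw [one_div] at h
    rw [← h, ← mul_neg, ← tsum_neg]
    congr 2
    ext n
    simp
    ring
  · have h := (hasSum_thetaChar_half 0 (x / (2 * ω₁)) hτ).tsum_eq
    simp only [theta, charSign, charA, charB, hz]
    simp only [mul_zero, add_zero] at h
    rw [tsum_mul_left, one_div] at h
    simp [← h]
  · have h := (hasSum_thetaChar_zero 0 (x / (2 * ω₁)) hτ).tsum_eq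
    simp only [theta, charSign, charA, charB, hz]
    simp only [mul_zero, add_zero] at h
    rw [tsum_mul_left] at h
    simp [h]
  · have h := (hasSum_thetaChar_zero (1 / 2) (x / (2 * ω₁)) hτ).tsum_eq
    simp only [theta, charSign, charA, charB, hz]
    simp only [heven] at h
    rw [tsum_mul_left] at h
    simp only [mul_assoc, mul_left_comm _ ((-1 : ℂ) ^ _)] at h ⊢
    simp [h]

/-! ### Parity, quasi-periods and half-period shifts -/

theorem thetaChar_add_one_left (a b u τ : ℂ) :
    thetaChar (a + 1) b u τ = thetaChar a b u τ := by
  unfold thetaChar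
  rw [show u + b + (a + 1) * τ = (u + b + a * τ) + τ by ring, jacobiTheta₂_add_left', ← mul_assoc,
    ← Complex.exp_add]
  congr 2
  ring

theorem thetaChar_add_one_right (a b u τ : ℂ) :
    thetaChar a (b + 1) u τ = cexp (2 * π * I * a) * thetaChar a b u τ := by
  unfold thetaChar
  rw [show u + (b + 1) + a * τ = (u + b + a * τ) + 1 by ring, jacobiTheta₂_add_left, ← mul_assoc,
    ← Complex.exp_add]
  congr 2
  ring

/-- Translating by `s + tτ` only moves the characteristics by `(t, s)`. Integral shifts give the
quasi-periods, half-integral ones permute the four theta functions. -/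
theorem thetaChar_shift (a b s t u τ : ℂ) :
    thetaChar a b (u + s + t * τ) τ =
      cexp (-π * I * t ^ 2 * τ - 2 * π * I * t * (u + b + s)) *
        thetaChar (a + t) (b + s) u τ := by
  unfold thetaChar
  rw [← mul_assoc, ← Complex.exp_add]
  congr 2 <;> ring

theorem thetaChar_neg (a b u τ : ℂ) : thetaChar a b (-u) τ = thetaChar (-a) (-b) u τ := by
  unfold thetaChar
  rw [← jacobiTheta₂_neg_left]
  congr 2 <;> ring

theorem exp_two_pi_I_mul_half : cexp (2 * π * I * (1 / 2)) = -1 := by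
  rw [show 2 * π * I * (1 / 2) = π * I by ring, Complex.exp_pi_mul_I]

section theta

variable {ω₁ τ : ℂ}

theorem theta_zero_eq (hτ : 0 < τ.im) (x : ℂ) :
    theta ω₁ τ 0 x = -thetaChar (1 / 2) (1 / 2) (x / (2 * ω₁)) τ := by
  simp [theta_eq ω₁ hτ, charSign, charA, charB]

/-- Negation sends the characteristics to `(-1/2, -1/2)`. Returning to `(1/2, 1/2)` costs nothing in
the first and a factor `exp(πi) = -1` in the second. -/
theorem theta_zero_neg (hτ : 0 < τ.im) (x : ℂ) : theta ω₁ τ 0 (-x) = -theta ω₁ τ 0 x := by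
  have h1 := thetaChar_add_one_left (-(1 / 2)) (-(1 / 2)) (x / (2 * ω₁)) τ
  have h2 := thetaChar_add_one_right (1 / 2) (-(1 / 2)) (x / (2 * ω₁)) τ
  have e : -(1 / 2 : ℂ) + 1 = 1 / 2 := by norm_num
  rw [e] at h1 h2
  rw [theta_zero_eq hτ, theta_zero_eq hτ, neg_div, thetaChar_neg, ← h1, h2, exp_two_pi_I_mul_half]
  ring

theorem theta_neg (hτ : 0 < τ.im) {ν : Fin 4} (hν : ν ≠ 0) (x : ℂ) :
    theta ω₁ τ ν (-x) = theta ω₁ τ ν x := by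
  rw [theta_eq ω₁ hτ, theta_eq ω₁ hτ, neg_div, thetaChar_neg]
  congr 1
  fin_cases ν
  · exact absurd rfl hν
  · have h1 := thetaChar_add_one_left (-(1 / 2)) 0 (x / (2 * ω₁)) τ
    rw [show -(1 / 2 : ℂ) + 1 = 1 / 2 by norm_num] at h1
    simpa [charA, charB] using h1.symm
  · simp [charA, charB]
  · have h1 := thetaChar_add_one_right 0 (-(1 / 2)) (x / (2 * ω₁)) τ
    rw [show -(1 / 2 : ℂ) + 1 = 1 / 2 by norm_num] at h1
    simpa [charA, charB] using h1.symm

theorem theta_zero_add_two_omega1 (hω : ω₁ ≠ 0) (hτ : 0 < τ.im) (x : ℂ) :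
    theta ω₁ τ 0 (x + 2 * ω₁) = -theta ω₁ τ 0 x := by
  have e : (x + 2 * ω₁) / (2 * ω₁) = x / (2 * ω₁) + 1 + 0 * τ := by field_simp; ring
  rw [theta_zero_eq hτ, theta_zero_eq hτ, e, thetaChar_shift, add_zero, thetaChar_add_one_right,
    exp_two_pi_I_mul_half]
  simp

theorem theta_zero_add_two_omega3 (hω : ω₁ ≠ 0) (hτ : 0 < τ.im) (x : ℂ) :
    theta ω₁ τ 0 (x + 2 * (τ * ω₁)) =
      -cexp (-π * I * τ) * cexp (-2 * π * I / (2 * ω₁) * x) * theta ω₁ τ 0 x := by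
  have e : (x + 2 * (τ * ω₁)) / (2 * ω₁) = x / (2 * ω₁) + 0 + 1 * τ := by field_simp; ring
  have e2 : -π * I * 1 ^ 2 * τ - 2 * π * I * 1 * (x / (2 * ω₁) + 1 / 2) =
      -π * I * τ + -2 * π * I / (2 * ω₁) * x + -(π * I) := by ring
  rw [theta_zero_eq hτ, theta_zero_eq hτ, e, thetaChar_shift, thetaChar_add_one_left]
  simp only [add_zero]
  rw [e2, Complex.exp_add, Complex.exp_add, Complex.exp_neg, Complex.exp_pi_mul_I]
  ring

/-- The exponent `d` in `θ_{ν+1}(x) = c exp (d x) θ₁(x + ω_ν)`. -/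
def shiftExponent (ω₁ : ℂ) : Fin 4 → ℂ := ![0, 0, -(π * I / (2 * ω₁)), π * I / (2 * ω₁)]

/-- This reduces all `x`-derivatives to those of `θ₁`: the factor `c` drops out of the logarithmic
derivative, and `exp(dx)` contributes only the constant `d`. -/
theorem exists_theta_eq_theta_zero (hω : ω₁ ≠ 0) (hτ : 0 < τ.im) (ν : Fin 4) :
    ∃ c : ℂ, c ≠ 0 ∧ ∀ x, theta ω₁ τ ν x = c * cexp (shiftExponent ω₁ ν * x) *
      theta ω₁ τ 0 (x + (![0, ω₁, -ω₁ - τ * ω₁, τ * ω₁] : Fin 4 → ℂ) ν) := by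
  fin_cases ν
  · exact ⟨1, one_ne_zero, fun x => by simp [shiftExponent]⟩
  · refine ⟨1, one_ne_zero, fun x => ?_⟩
    have e : (x + ω₁) / (2 * ω₁) = x / (2 * ω₁) + 1 / 2 + 0 * τ := by field_simp; ring
    have h := thetaChar_add_one_right (1 / 2) 0 (x / (2 * ω₁)) τ
    simp only [shiftExponent, Fin.isValue, Fin.mk_one, Matrix.cons_val_one, Matrix.cons_val_zero]
    rw [theta_zero_eq hτ, theta_eq ω₁ hτ, e, thetaChar_shift, add_zero (1 / 2 : ℂ),
      show thetaChar (1 / 2) (1 / 2 + 1 / 2) (x / (2 * ω₁)) τ =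
        thetaChar (1 / 2) (0 + 1) (x / (2 * ω₁)) τ by norm_num, h, exp_two_pi_I_mul_half]
    simp [charSign, charA, charB]
  -- The inverse of the constant factor of `thetaChar_shift` at `t = -1/2`, with the sign of `θ₁`;
  -- below, the case `t = 1/2` has an extra `πi/2` from `b = 1/2`.
  · refine ⟨-cexp (π * I * τ / 4), by simp, fun x => ?_⟩
    have e : (x + (-ω₁ - τ * ω₁)) / (2 * ω₁) = x / (2 * ω₁) + -(1 / 2) + -(1 / 2) * τ := by
      field_simp; ring
    simp only [shiftExponent, Fin.isValue, Fin.reduceFinMk, Matrix.cons_val]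
    rw [theta_zero_eq hτ, theta_eq ω₁ hτ, e, thetaChar_shift]
    have e2 : -π * I * (-(1 / 2)) ^ 2 * τ -
        2 * π * I * (-(1 / 2)) * (x / (2 * ω₁) + 1 / 2 + -(1 / 2)) =
        -(π * I * τ / 4 + -(π * I / (2 * ω₁)) * x) := by ring
    rw [e2, Complex.exp_neg]
    have h0 := Complex.exp_ne_zero (π * I * τ / 4 + -(π * I / (2 * ω₁)) * x)
    simp only [neg_mul, mul_neg, neg_neg]
    rw [← Complex.exp_add, ← mul_assoc, ← neg_mul (π * I / (2 * ω₁)) x, mul_inv_cancel₀ h0]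
    simp [charSign, charA, charB]
  · refine ⟨-cexp (π * I * τ / 4 + π * I / 2), by simp, fun x => ?_⟩
    have e : (x + τ * ω₁) / (2 * ω₁) = x / (2 * ω₁) + 0 + 1 / 2 * τ := by field_simp; ring
    simp only [shiftExponent, Fin.isValue, Fin.reduceFinMk, Matrix.cons_val]
    rw [theta_zero_eq hτ, theta_eq ω₁ hτ, e, thetaChar_shift]
    have e2 : -π * I * (1 / 2) ^ 2 * τ - 2 * π * I * (1 / 2) * (x / (2 * ω₁) + 1 / 2 + 0) =
        -(π * I * τ / 4 + π * I / 2 + π * I / (2 * ω₁) * x) := by ring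
    rw [e2, Complex.exp_neg]
    have h0 := Complex.exp_ne_zero (π * I * τ / 4 + π * I / 2 + π * I / (2 * ω₁) * x)
    simp only [neg_mul, mul_neg, neg_neg]
    rw [← Complex.exp_add, ← mul_assoc, mul_inv_cancel₀ h0]
    have h := thetaChar_add_one_left 0 (1 / 2) (x / (2 * ω₁)) τ
    rw [add_zero (1 / 2 : ℂ), show thetaChar (1 / 2 + 1 / 2) (1 / 2) (x / (2 * ω₁)) τ =
        thetaChar (0 + 1) (1 / 2) (x / (2 * ω₁)) τ by norm_num, h]
    simp [charSign, charA, charB]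

/-! ### Derivatives of the theta functions in `x` and `β` -/

theorem theta_eq_fun (hτ : 0 < τ.im) (ν : Fin 4) :
    theta ω₁ τ ν = fun x => charSign ν * thetaChar (charA ν) (charB ν) (x / (2 * ω₁)) τ :=
  funext (theta_eq ω₁ hτ ν)

theorem hasDerivAt_theta (hτ : 0 < τ.im) (ν : Fin 4) (x : ℂ) :
    HasDerivAt (theta ω₁ τ ν)
      (charSign ν * (thetaChar' (charA ν) (charB ν) (x / (2 * ω₁)) τ * (1 / (2 * ω₁)))) x := by
  rw [theta_eq_fun hτ]
  exact (HasDerivAt.comp x (h₂ := fun u => thetaChar (charA ν) (charB ν) u τ)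
    (h := fun x => x / (2 * ω₁)) (hasDerivAt_thetaChar _ _ _ hτ)
    ((hasDerivAt_id x).div_const (2 * ω₁))).const_mul _

theorem deriv_theta (hτ : 0 < τ.im) (ν : Fin 4) :
    deriv (theta ω₁ τ ν) = fun x =>
      charSign ν * (thetaChar' (charA ν) (charB ν) (x / (2 * ω₁)) τ * (1 / (2 * ω₁))) :=
  funext fun x => (hasDerivAt_theta hτ ν x).deriv

theorem deriv_deriv_theta (hτ : 0 < τ.im) (ν : Fin 4) (x : ℂ) :
    deriv (deriv (theta ω₁ τ ν)) x = charSign ν *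
      (thetaChar'' (charA ν) (charB ν) (x / (2 * ω₁)) τ * (1 / (2 * ω₁)) * (1 / (2 * ω₁))) := by
  rw [deriv_theta hτ]
  exact (((HasDerivAt.comp x (h₂ := fun u => thetaChar' (charA ν) (charB ν) u τ)
    (h := fun x => x / (2 * ω₁)) (hasDerivAt_thetaChar' _ _ _ hτ)
    ((hasDerivAt_id x).div_const (2 * ω₁))).mul_const _).const_mul _).deriv

theorem differentiable_theta (hτ : 0 < τ.im) (ν : Fin 4) : Differentiable ℂ (theta ω₁ τ ν) :=
  fun x => (hasDerivAt_theta hτ ν x).differentiableAt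

/-- Joint differentiability of the theta functions in `(x, β)`, with the heat equation
`∂θ/∂β = (1/2) ∂²θ/∂x²`. -/
theorem hasFDerivAt_theta {β : ℂ} (hτ : 0 < (tau ω₁ β).im) (ν : Fin 4) (x : ℂ) :
    HasFDerivAt (fun p : ℂ × ℂ => theta ω₁ (tau ω₁ p.2) ν p.1)
      (deriv (theta ω₁ (tau ω₁ β) ν) x • ContinuousLinearMap.fst ℂ ℂ ℂ +
        (deriv (deriv (theta ω₁ (tau ω₁ β) ν)) x / 2) • ContinuousLinearMap.snd ℂ ℂ ℂ)
      (x, β) := by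
  have hω : ω₁ ≠ 0 := by rintro rfl; simp [tau] at hτ
  have hpi : (π : ℂ) ≠ 0 := by exact_mod_cast Real.pi_ne_zero
  have f1 : HasFDerivAt (fun p : ℂ × ℂ => p.1) (ContinuousLinearMap.fst ℂ ℂ ℂ) (x, β) :=
    hasFDerivAt_fst
  have f2 : HasFDerivAt (fun p : ℂ × ℂ => p.2) (ContinuousLinearMap.snd ℂ ℂ ℂ) (x, β) :=
    hasFDerivAt_snd
  have hin := (f1.mul_const (1 / (2 * ω₁))).prodMk
    (f2.const_mul (π * Complex.I / (2 * ω₁ ^ 2)))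
  have et : ∀ b, tau ω₁ b = π * Complex.I / (2 * ω₁ ^ 2) * b := fun b => by unfold tau; ring
  have hT := hasFDerivAt_thetaChar (charA ν) (charB ν) (x * (1 / (2 * ω₁))) (et β ▸ hτ)
  have h := (HasFDerivAt.comp (x, β) hT hin).const_mul (charSign ν)
  have hev : (fun p : ℂ × ℂ => theta ω₁ (tau ω₁ p.2) ν p.1) =ᶠ[𝓝 (x, β)]
      fun p => charSign ν * (thetaChar (charA ν) (charB ν) (p.1 * (1 / (2 * ω₁)))
        (π * Complex.I / (2 * ω₁ ^ 2) * p.2)) := by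
    have ho : ∀ᶠ p : ℂ × ℂ in 𝓝 (x, β), 0 < (tau ω₁ p.2).im := by
      have hc : Continuous fun p : ℂ × ℂ => (tau ω₁ p.2).im := by
        simp only [et]; fun_prop
      exact hc.continuousAt.eventually (lt_mem_nhds hτ)
    filter_upwards [ho] with p hp
    rw [theta_eq ω₁ hp, et, div_eq_mul_one_div p.1]
  refine (HasFDerivAt.congr_of_eventuallyEq h hev).congr_fderiv ?_
  -- The factor `1/2`: `dτ/dβ = πi/(2ω₁²)` times `1/(4πi)` is `1/(8ω₁²)`, while two `x`-derivatives
  -- contribute `1/(4ω₁²)`.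
  rw [deriv_deriv_theta hτ, deriv_theta hτ, ← et, ← div_eq_mul_one_div x]
  ext
  · simp
  · simp
    field_simp
    ring

end theta

/-! ### Fourier coefficients and theta functions of order two -/

/-- The integral of a `1`-periodic entire function over a horizontal period segment does not
depend on the segment. -/
theorem integral_add_eq_of_periodic {g : ℂ → ℂ} (hg : Differentiable ℂ g)
    (hper : ∀ u, g (u + 1) = g u) (w : ℂ) :
    ∫ t in (0 : ℝ)..1, g (t + w) = ∫ t in (0 : ℝ)..1, g t := by
  obtain ⟨G, hG⟩ := hg.isExactOn_univ
  have hG' : ∀ z, HasDerivAt G (g z) z := fun z => hG z (Set.mem_univ z)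
  have key : ∀ w : ℂ, ∫ t in (0 : ℝ)..1, g (t + w) = G (w + 1) - G w := by
    intro w
    have h := intervalIntegral.integral_eq_sub_of_hasDerivAt (a := (0 : ℝ)) (b := 1)
      (f := fun t : ℝ => G (t + w)) (f' := fun t : ℝ => g (t + w))
      (fun t _ => ((hG' (t + w)).comp_add_const (t : ℂ) w).comp_ofReal)
      (Continuous.intervalIntegrable (hg.continuous.comp (by fun_prop)) _ _)
    rw [h]
    simp [add_comm]
  -- The derivative of `G(w+1) - G(w)` is `g(w+1) - g(w) = 0`.
  have hconst : G (w + 1) - G w = G (0 + 1) - G 0 := by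
    have hd : ∀ w, HasDerivAt (fun w => G (w + 1) - G w) 0 w := fun w =>
      (((hG' (w + 1)).comp_add_const w 1).sub (hG' w)).congr_deriv (by rw [hper, sub_self])
    exact is_const_of_deriv_eq_zero (fun w => (hd w).differentiableAt) (fun w => (hd w).deriv) w 0
  rw [key w, hconst, ← key 0]
  simp

/-- The Fourier coefficients of a `1`-periodic function on `ℂ`. -/
def coeffInt (f : ℂ → ℂ) (n : ℤ) : ℂ :=
  ∫ t in (0 : ℝ)..1, cexp (-2 * π * I * n * t) * f t

theorem intervalIntegrable_coeffInt {f : ℂ → ℂ} (hf : Differentiable ℂ f) (n : ℤ) :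
    IntervalIntegrable (fun t : ℝ => cexp (-2 * π * I * n * t) * f t) MeasureTheory.volume 0 1 := by
  have := hf.continuous
  exact Continuous.intervalIntegrable (by fun_prop) _ _

theorem coeffInt_add {f g : ℂ → ℂ} (hf : Differentiable ℂ f) (hg : Differentiable ℂ g) (n : ℤ) :
    coeffInt (fun u => f u + g u) n = coeffInt f n + coeffInt g n := by
  unfold coeffInt
  rw [← intervalIntegral.integral_add (intervalIntegrable_coeffInt hf n)
    (intervalIntegrable_coeffInt hg n)]
  simp only [mul_add]

theorem coeffInt_const_mul (c : ℂ) (f : ℂ → ℂ) (n : ℤ) :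
    coeffInt (fun u => c * f u) n = c * coeffInt f n := by
  unfold coeffInt
  rw [← intervalIntegral.integral_const_mul]
  simp only [mul_left_comm]

/-- On the real line the function descends to the circle, where its Fourier series vanishes; the
identity theorem extends this to `ℂ`. -/
theorem eq_zero_of_coeffInt_eq_zero {f : ℂ → ℂ} (hf : Differentiable ℂ f)
    (hper : ∀ u, f (u + 1) = f u) (h : ∀ n, coeffInt f n = 0) (u : ℂ) : f u = 0 := by
  have hp : Function.Periodic (fun t : ℝ => f t) 1 := fun t => by simpa using hper t
  obtain ⟨F, hF⟩ : ∃ F : C(AddCircle (1 : ℝ), ℂ), ∀ t : ℝ, F (t : AddCircle (1 : ℝ)) = f t :=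
    ⟨⟨hp.lift, continuous_coinduced_dom.mpr (hf.continuous.comp continuous_ofReal)⟩,
      fun t => hp.lift_coe t⟩
  have hc : ∀ n, fourierCoeff F n = 0 := by
    intro n
    rw [fourierCoeff_eq_intervalIntegral F n 0, zero_add, one_div, inv_one, one_smul, ← h n, coeffInt]
    refine intervalIntegral.integral_congr fun t _ => ?_
    simp only [hF, smul_eq_mul, fourier_coe_apply]
    push_cast
    congr 2
    ring
  have hs := hasSum_fourier_series_of_summable (f := F) (by
    rw [show fourierCoeff F = fun _ => 0 from funext hc]
    exact summable_zero)
  have hz : (fun i => fourierCoeff F i • fourier i) = fun _ => (0 : C(AddCircle (1 : ℝ), ℂ)) := by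
    funext i
    rw [hc i]
    exact zero_smul ℂ (fourier (T := 1) i)
  rw [hz] at hs
  have hF0 : F = 0 := hs.unique hasSum_zero
  have hreal : ∀ t : ℝ, f t = 0 := fun t => by rw [← hF, hF0]; rfl
  have ha : AnalyticOnNhd ℂ f Set.univ := fun z _ => hf.analyticAt z
  refine ha.eqOn_zero_of_preconnected_of_frequently_eq_zero isPreconnected_univ
    (Set.mem_univ 0) ?_ (Set.mem_univ u)
  have ht : Tendsto (fun t : ℝ => (t : ℂ)) (𝓝[≠] 0) (𝓝[≠] 0) := by
    refine tendsto_nhdsWithin_iff.mpr ⟨?_, ?_⟩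
    · exact (continuous_ofReal.tendsto' 0 0 (by simp)).mono_left nhdsWithin_le_nhds
    · filter_upwards [self_mem_nhdsWithin] with t ht
      simpa using ht
  exact ht.frequently (Frequently.of_forall hreal)

/-- A theta function of order two is determined by its Fourier coefficients `0` and `1`. -/
theorem eq_zero_of_order_two {f : ℂ → ℂ} (hf : Differentiable ℂ f) (hper : ∀ u, f (u + 1) = f u)
    {τ C : ℂ} (hC : C ≠ 0) (hτ : ∀ u, f (u + τ) = C * cexp (-4 * π * I * u) * f u)
    (h0 : coeffInt f 0 = 0) (h1 : coeffInt f 1 = 0) (u : ℂ) : f u = 0 := by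
  -- Move the path of integration by `τ`. The multiplier `exp(-4πiu)` raises the frequency by two,
  -- so coefficients of equal parity determine each other.
  have hrec : ∀ n : ℤ, coeffInt f n = C * cexp (-2 * π * I * n * τ) * coeffInt f (n + 2) := by
    intro n
    have hd : Differentiable ℂ fun u => cexp (-2 * π * I * n * u) * f u := by fun_prop
    have hp : ∀ u, cexp (-2 * π * I * n * (u + 1)) * f (u + 1) =
        cexp (-2 * π * I * n * u) * f u := fun u => by
      rw [hper, show -2 * π * I * n * (u + 1) = -2 * π * I * n * u + (-n : ℤ) * (2 * π * I) by
        push_cast; ring, Complex.exp_add, Complex.exp_int_mul_two_pi_mul_I, mul_one]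
    have h := integral_add_eq_of_periodic hd hp τ
    rw [coeffInt, ← h, coeffInt, ← intervalIntegral.integral_const_mul]
    refine intervalIntegral.integral_congr fun t _ => ?_
    simp only [hτ]
    rw [show -2 * π * I * n * (t + τ) = -2 * π * I * n * τ + -2 * π * I * n * t by ring,
      show (-2 * π * I * ((n + 2 : ℤ) : ℂ) * t) = -2 * π * I * n * t + -4 * π * I * t by
        push_cast; ring, Complex.exp_add, Complex.exp_add]
    ring
  have hall : ∀ n : ℤ, coeffInt f n = 0 ∧ coeffInt f (n + 1) = 0 := by
    intro n
    induction n using Int.induction_on with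
    | zero => exact ⟨h0, by simpa using h1⟩
    | succ i ih =>
      refine ⟨ih.2, ?_⟩
      have := ih.1
      rw [hrec] at this
      rw [add_assoc]
      exact (mul_eq_zero.mp this).resolve_left (mul_ne_zero hC (Complex.exp_ne_zero _))
    | pred i ih =>
      rw [sub_add_cancel]
      refine ⟨?_, ih.1⟩
      rw [hrec, show (-(i : ℤ) - 1 + 2) = -(i : ℤ) + 1 by ring, ih.2, mul_zero]
  exact eq_zero_of_coeffInt_eq_zero hf hper (fun n => (hall n).1) u

/-- An entire function which is not identically zero has isolated zeros. -/
theorem eventually_ne_zero_of_differentiable {f : ℂ → ℂ} (hf : Differentiable ℂ f)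
    (h : ∃ x, f x ≠ 0) (a : ℂ) : ∀ᶠ z in 𝓝[≠] a, f z ≠ 0 := by
  have ha : AnalyticOnNhd ℂ f Set.univ := fun z _ => hf.analyticAt z
  by_contra hc
  obtain ⟨x, hx⟩ := h
  exact hx (ha.eqOn_zero_of_preconnected_of_frequently_eq_zero isPreconnected_univ
    (Set.mem_univ a) ((not_eventually.mp hc).mono fun _ => not_not.mp) (Set.mem_univ x))

theorem omega1_ne_zero (L : PeriodPair) : L.ω₁ ≠ 0 := by
  simpa using L.indep.ne_zero 0

/-- `℘` has order `-2` at `0`, whereas a constant has order `0` or `⊤`. -/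
theorem not_eventually_const_weierstrassP (L : PeriodPair) (c : ℂ) :
    ¬ L.weierstrassP =ᶠ[𝓝[≠] 0] fun _ => c := by
  intro hev
  have ho := L.order_weierstrassP 0 (zero_mem _)
  classical
  rw [meromorphicOrderAt_congr hev, meromorphicOrderAt_const] at ho
  split_ifs at ho with h0
  · exact absurd ho (by decide)
  · exact absurd ho (by decide)

theorem eventually_notMem_lattice (L : PeriodPair) (a : ℂ) :
    ∀ᶠ z in 𝓝[≠] a, z ∉ L.lattice := by
  filter_upwards [nhdsWithin_le_nhds (L.compl_lattice_sdiff_singleton_mem_nhds a),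
    self_mem_nhdsWithin] with z hz hza hzl
  exact hz ⟨hzl, hza⟩

/-- The properties of the theta function `θ₁` as a function of `x`: it is an odd entire function
with the quasi-periods of a theta function of order one. -/
structure IsOddTheta (L : PeriodPair) (θ : ℂ → ℂ) : Prop where
  differentiable : Differentiable ℂ θ
  odd : ∀ x, θ (-x) = -θ x
  add_omega1 : ∀ x, θ (x + L.ω₁) = -θ x
  add_omega2 : ∃ A : ℂ, A ≠ 0 ∧
    ∀ x, θ (x + L.ω₂) = A * cexp (-2 * π * I / L.ω₁ * x) * θ x
  exists_ne_zero : ∃ x, θ x ≠ 0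

/-- Entire functions with the quasi-periods of a theta function of order two. -/
structure IsOrderTwo (L : PeriodPair) (C : ℂ) (f : ℂ → ℂ) : Prop where
  differentiable : Differentiable ℂ f
  add_omega1 : ∀ x, f (x + L.ω₁) = f x
  add_omega2 : ∀ x, f (x + L.ω₂) = C * cexp (-4 * π * I / L.ω₁ * x) * f x

namespace IsOrderTwo

variable {L : PeriodPair} {C : ℂ} {f g : ℂ → ℂ}

theorem add (hf : IsOrderTwo L C f) (hg : IsOrderTwo L C g) :
    IsOrderTwo L C fun x => f x + g x where
  differentiable := hf.differentiable.add hg.differentiable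
  add_omega1 x := by rw [hf.add_omega1, hg.add_omega1]
  add_omega2 x := by rw [hf.add_omega2, hg.add_omega2]; ring

theorem const_mul (c : ℂ) (hf : IsOrderTwo L C f) : IsOrderTwo L C fun x => c * f x where
  differentiable := hf.differentiable.const_mul c
  add_omega1 x := by rw [hf.add_omega1]
  add_omega2 x := by rw [hf.add_omega2]; ring

/-- The Fourier coefficients with respect to the period `ω₁`. -/
def coeff (L : PeriodPair) (f : ℂ → ℂ) (n : ℤ) : ℂ := coeffInt (fun u => f (L.ω₁ * u)) n

theorem coeff_add (hf : IsOrderTwo L C f) (hg : IsOrderTwo L C g) (n : ℤ) :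
    coeff L (fun x => f x + g x) n = coeff L f n + coeff L g n :=
  coeffInt_add (hf.differentiable.comp (differentiable_id.const_mul L.ω₁))
    (hg.differentiable.comp (differentiable_id.const_mul L.ω₁)) n

theorem coeff_const_mul (c : ℂ) (f : ℂ → ℂ) (n : ℤ) :
    coeff L (fun x => c * f x) n = c * coeff L f n :=
  coeffInt_const_mul c _ n

theorem eq_zero (hC : C ≠ 0) (hf : IsOrderTwo L C f) (h0 : coeff L f 0 = 0)
    (h1 : coeff L f 1 = 0) (x : ℂ) : f x = 0 := by
  have hω := omega1_ne_zero L
  have h := eq_zero_of_order_two (f := fun u => f (L.ω₁ * u)) (τ := L.ω₂ / L.ω₁)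
    (hf.differentiable.comp (differentiable_id.const_mul L.ω₁))
    (fun u => by simp only [mul_add, mul_one, hf.add_omega1]) hC
    (fun u => by
      rw [mul_add, mul_div_cancel₀ _ hω, hf.add_omega2]
      congr 3
      field_simp) h0 h1 (x / L.ω₁)
  simpa [mul_div_cancel₀ _ hω] using h

/-- Any three theta functions of order two are linearly dependent. -/
theorem exists_linear_combination (hC : C ≠ 0) {f₁ f₂ f₃ : ℂ → ℂ} (h₁ : IsOrderTwo L C f₁)
    (h₂ : IsOrderTwo L C f₂) (h₃ : IsOrderTwo L C f₃)
    (hind : ∀ s t : ℂ, (∀ x, s * f₁ x + t * f₂ x = 0) → s = 0 ∧ t = 0) :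
    ∃ α β : ℂ, ∀ x, f₃ x = α * f₁ x + β * f₂ x := by
  have comb2 : ∀ s t : ℂ, s * coeff L f₁ 0 + t * coeff L f₂ 0 = 0 →
      s * coeff L f₁ 1 + t * coeff L f₂ 1 = 0 → s = 0 ∧ t = 0 := by
    intro s t e0 e1
    refine hind s t fun x => ?_
    refine ((h₁.const_mul s).add (h₂.const_mul t)).eq_zero hC ?_ ?_ x
    · rw [coeff_add (h₁.const_mul s) (h₂.const_mul t), coeff_const_mul, coeff_const_mul, e0]
    · rw [coeff_add (h₁.const_mul s) (h₂.const_mul t), coeff_const_mul, coeff_const_mul, e1]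
  -- If the determinant vanished, its rows would give relations forcing both coefficients of `f₁` to
  -- be zero, hence `f₁ = 0`, against independence.
  have hD : coeff L f₁ 0 * coeff L f₂ 1 - coeff L f₁ 1 * coeff L f₂ 0 ≠ 0 := by
    intro hD
    obtain ⟨a1, a2⟩ := comb2 (coeff L f₂ 1) (-coeff L f₁ 1) (by linear_combination hD) (by ring)
    obtain ⟨a3, a4⟩ := comb2 (coeff L f₂ 0) (-coeff L f₁ 0) (by ring) (by linear_combination -hD)
    rw [neg_eq_zero] at a2 a4
    exact one_ne_zero (comb2 1 0 (by simp [a4]) (by simp [a2])).1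
  set D := coeff L f₁ 0 * coeff L f₂ 1 - coeff L f₁ 1 * coeff L f₂ 0 with hDdef
  -- Cramer's rule for the coefficients `0` and `1` of `f₃`.
  set α := (coeff L f₃ 0 * coeff L f₂ 1 - coeff L f₃ 1 * coeff L f₂ 0) / D with hα
  set β := (coeff L f₁ 0 * coeff L f₃ 1 - coeff L f₁ 1 * coeff L f₃ 0) / D with hβ
  refine ⟨α, β, fun x => ?_⟩
  have h := ((h₁.const_mul α).add (h₂.const_mul β)).add (h₃.const_mul (-1))
  have e := h.eq_zero hC ?_ ?_ x
  · linear_combination -e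
  · rw [coeff_add ((h₁.const_mul α).add (h₂.const_mul β)) (h₃.const_mul (-1)),
      coeff_add (h₁.const_mul α) (h₂.const_mul β), coeff_const_mul, coeff_const_mul,
      coeff_const_mul, hα, hβ]
    field_simp
    rw [hDdef]
    ring
  · rw [coeff_add ((h₁.const_mul α).add (h₂.const_mul β)) (h₃.const_mul (-1)),
      coeff_add (h₁.const_mul α) (h₂.const_mul β), coeff_const_mul, coeff_const_mul,
      coeff_const_mul, hα, hβ]
    field_simp
    rw [hDdef]
    ring

end IsOrderTwo

/-! ### The addition formula for an odd theta function -/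

namespace IsOddTheta

variable {L : PeriodPair} {θ : ℂ → ℂ}

theorem map_zero (h : IsOddTheta L θ) : θ 0 = 0 := by
  have := h.odd 0
  rw [neg_zero] at this
  exact self_eq_neg.mp this

/-- Every lattice point is a quasi-period. -/
theorem exists_quasiPeriod (h : IsOddTheta L θ) {l : ℂ} (hl : l ∈ L.lattice) :
    ∃ B c : ℂ, B ≠ 0 ∧ ∀ x, θ (x + l) = B * cexp (c * x) * θ x := by
  rw [PeriodPair.lattice, ← Submodule.mem_toAddSubgroup,
    Submodule.span_int_eq_addSubgroupClosure] at hl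
  induction hl using AddSubgroup.closure_induction with
  | mem x hx =>
    rcases hx with rfl | rfl
    · exact ⟨-1, 0, by simp, fun x => by simp [h.add_omega1]⟩
    · obtain ⟨A, hA, hAx⟩ := h.add_omega2
      exact ⟨A, _, hA, hAx⟩
  | zero => exact ⟨1, 0, one_ne_zero, fun x => by simp⟩
  | add a b _ _ ha hb =>
    obtain ⟨B, c, hB, hBc⟩ := ha
    obtain ⟨B', c', hB', hBc'⟩ := hb
    refine ⟨B * B' * cexp (c' * a), c + c', by simp [hB, hB'], fun x => ?_⟩
    rw [← add_assoc, hBc', hBc, mul_add, Complex.exp_add, add_mul, Complex.exp_add]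
    ring
  | neg a _ ha =>
    obtain ⟨B, c, hB, hBc⟩ := ha
    refine ⟨B⁻¹ * cexp (c * a), -c, by simp [hB], fun x => ?_⟩
    have h1 := hBc (x + -a)
    rw [neg_add_cancel_right, mul_add, mul_neg, Complex.exp_add] at h1
    rw [h1, neg_mul, Complex.exp_neg, Complex.exp_neg]
    have := Complex.exp_ne_zero (c * x)
    have := Complex.exp_ne_zero (c * a)
    field_simp

theorem map_lattice (h : IsOddTheta L θ) {l : ℂ} (hl : l ∈ L.lattice) : θ l = 0 := by
  obtain ⟨B, c, -, hBc⟩ := h.exists_quasiPeriod hl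
  simpa [h.map_zero] using hBc 0

theorem notMem_lattice (h : IsOddTheta L θ) {x : ℂ} (hx : θ x ≠ 0) : x ∉ L.lattice :=
  fun hl => hx (h.map_lattice hl)

open Classical in
/-- The entire function extending `℘ θ²`. -/
def wpMulSq (L : PeriodPair) (θ : ℂ → ℂ) (x : ℂ) : ℂ :=
  if x ∈ L.lattice then deriv θ x ^ 2 else L.weierstrassP x * θ x ^ 2

theorem wpMulSq_of_notMem {x : ℂ} (hx : x ∉ L.lattice) :
    wpMulSq L θ x = L.weierstrassP x * θ x ^ 2 := if_neg hx

theorem wpMulSq_of_mem {x : ℂ} (hx : x ∈ L.lattice) : wpMulSq L θ x = deriv θ x ^ 2 := if_pos hx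

/-- Near a lattice point `a` the double pole of `℘` is absorbed by the zero of `θ`: `θ(z)²/(z-a)²`
is the square of `dslope θ a`, with value `θ'(a)²` at `a`. -/
theorem differentiable_wpMulSq (h : IsOddTheta L θ) : Differentiable ℂ (wpMulSq L θ) := by
  intro a
  by_cases ha : a ∈ L.lattice
  · have hev : wpMulSq L θ =ᶠ[𝓝 a] fun z => dslope θ a z ^ 2 +
        (L.weierstrassPExcept a z - 1 / a ^ 2) * θ z ^ 2 := by
      filter_upwards [L.compl_lattice_sdiff_singleton_mem_nhds a] with z hz
      by_cases hza : z = a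
      · subst hza
        simp [wpMulSq_of_mem ha, h.map_lattice ha]
      · have hzl : z ∉ L.lattice := fun hzl => hz ⟨hzl, hza⟩
        have hne : z - a ≠ 0 := sub_ne_zero.mpr hza
        rw [wpMulSq_of_notMem hzl, dslope_of_ne _ hza, slope_def_field, h.map_lattice ha,
          ← L.weierstrassPExcept_add ⟨a, ha⟩ z]
        simp only
        field_simp
        ring
    refine DifferentiableAt.congr_of_eventuallyEq ?_ hev
    have h1 : DifferentiableAt ℂ (dslope θ a) a :=
      ((Complex.differentiableOn_dslope univ_mem).mpr
        h.differentiable.differentiableOn).differentiableAt univ_mem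
    have h2 : DifferentiableAt ℂ (L.weierstrassPExcept a) a :=
      (L.analyticAt_weierstrassPExcept a).differentiableAt
    have h3 := h.differentiable a
    fun_prop
  · have hev : wpMulSq L θ =ᶠ[𝓝 a] fun z => L.weierstrassP z * θ z ^ 2 := by
      filter_upwards [L.isClosed_lattice.isOpen_compl.mem_nhds ha] with z hz
      exact wpMulSq_of_notMem hz
    refine DifferentiableAt.congr_of_eventuallyEq ?_ hev
    have h2 : DifferentiableAt ℂ L.weierstrassP a := (L.analyticOnNhd_weierstrassP a ha).differentiableAt
    have h3 := h.differentiable a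
    fun_prop

/-- Off the lattice this is periodicity of `℘`. At lattice points the quasi-periodicity of `θ` is
differentiated, and the term containing `θ(x) = 0` drops out. -/
theorem wpMulSq_add (h : IsOddTheta L θ) {l B c : ℂ} (hl : l ∈ L.lattice)
    (hB : ∀ x, θ (x + l) = B * cexp (c * x) * θ x) (x : ℂ) :
    wpMulSq L θ (x + l) = B ^ 2 * cexp (2 * c * x) * wpMulSq L θ x := by
  have e2 : cexp (2 * c * x) = cexp (c * x) ^ 2 := by
    rw [← Complex.exp_nat_mul]; push_cast; ring_nf
  by_cases hx : x ∈ L.lattice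
  · rw [wpMulSq_of_mem hx, wpMulSq_of_mem (add_mem hx hl)]
    have hd1 : HasDerivAt (fun y => θ (y + l)) (deriv θ (x + l)) x :=
      (h.differentiable (x + l)).hasDerivAt.comp_add_const x l
    have hd2 : HasDerivAt (fun y => B * cexp (c * y) * θ y)
        (B * (cexp (c * x) * c) * θ x + B * cexp (c * x) * deriv θ x) x := by
      have := ((((hasDerivAt_id x).const_mul c).cexp).const_mul B).mul
        (h.differentiable x).hasDerivAt
      exact this.congr_deriv (by simp)
    have e := (hd1.congr_of_eventuallyEq (Eventually.of_forall fun y => (hB y).symm)).unique hd2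
    rw [e, h.map_lattice hx, e2]
    ring
  · have hx' : x + l ∉ L.lattice := fun hc => hx (by simpa using sub_mem hc hl)
    rw [wpMulSq_of_notMem hx, wpMulSq_of_notMem hx', hB, L.weierstrassP_add_coe x ⟨l, hl⟩, e2]
    ring

/-- In the product `θ(x+y)θ(x-y)` the contributions of `y` to the multiplier cancel, so one constant
`C` serves all `y`; `℘θ²` has the multiplier of `θ²`, the case `y = 0`. -/
theorem isOrderTwo (h : IsOddTheta L θ) : ∃ C : ℂ, C ≠ 0 ∧ IsOrderTwo L C (wpMulSq L θ) ∧
    ∀ y, IsOrderTwo L C fun x => θ (x + y) * θ (x - y) := by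
  obtain ⟨A, hA, hAx⟩ := h.add_omega2
  refine ⟨A ^ 2, pow_ne_zero 2 hA, ⟨h.differentiable_wpMulSq, fun x => ?_, fun x => ?_⟩,
    fun y => ⟨?_, fun x => ?_, fun x => ?_⟩⟩
  · simpa using h.wpMulSq_add (B := -1) (c := 0) L.ω₁_mem_lattice
      (fun x => by simp [h.add_omega1]) x
  · rw [h.wpMulSq_add L.ω₂_mem_lattice hAx]
    congr 3
    ring
  · have := h.differentiable
    fun_prop
  · rw [add_right_comm, add_sub_right_comm, h.add_omega1, h.add_omega1]
    ring
  · rw [add_right_comm, add_sub_right_comm, hAx, hAx, show -4 * π * I / L.ω₁ * x =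
      -2 * π * I / L.ω₁ * (x + y) + -2 * π * I / L.ω₁ * (x - y) by ring, Complex.exp_add]
    ring

theorem eventually_ne_zero (h : IsOddTheta L θ) (a : ℂ) : ∀ᶠ z in 𝓝[≠] a, θ z ≠ 0 :=
  eventually_ne_zero_of_differentiable h.differentiable h.exists_ne_zero a

theorem linearIndependent_wpMulSq (h : IsOddTheta L θ) (s t : ℂ)
    (hst : ∀ x, s * (θ (x + 0) * θ (x - 0)) + t * wpMulSq L θ x = 0) : s = 0 ∧ t = 0 := by
  have ht : t = 0 := by
    by_contra ht
    have hev : L.weierstrassP =ᶠ[𝓝[≠] 0] fun _ => -s / t := by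
      filter_upwards [h.eventually_ne_zero 0] with z hz
      have e := hst z
      rw [wpMulSq_of_notMem (h.notMem_lattice hz), add_zero, sub_zero] at e
      have e2 : θ z ^ 2 * (s + t * L.weierstrassP z) = 0 := by linear_combination e
      have e3 := (mul_eq_zero.mp e2).resolve_left (pow_ne_zero 2 hz)
      field_simp
      linear_combination e3
    exact not_eventually_const_weierstrassP L _ hev
  refine ⟨?_, ht⟩
  obtain ⟨x, hx⟩ := h.exists_ne_zero
  have e := hst x
  rw [ht, zero_mul, add_zero, add_zero, sub_zero] at e
  simpa [hx] using e

/-- By dimension, `θ(x+y)θ(x-y)` is a combination of `θ²` and `℘θ²`. The zero at `x = y` fixes the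
ratio of the coefficients and `x = 0` the scale. No division by `θ'(0)²` occurs, because its
nonvanishing is deduced from this lemma. -/
theorem addition_aux (h : IsOddTheta L θ) {y : ℂ} (hy : θ y ≠ 0) :
    ∃ β : ℂ, β * deriv θ 0 ^ 2 = -θ y ^ 2 ∧
      ∀ x, θ (x + y) * θ (x - y) = β * (wpMulSq L θ x - L.weierstrassP y * θ x ^ 2) := by
  obtain ⟨C, hC, h2, h3⟩ := h.isOrderTwo
  obtain ⟨α, β, hαβ⟩ := IsOrderTwo.exists_linear_combination hC (h3 0) h2 (h3 y)
    h.linearIndependent_wpMulSq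
  simp only [add_zero, sub_zero] at hαβ
  have hα : α = -β * L.weierstrassP y := by
    have e := hαβ y
    rw [sub_self, h.map_zero, wpMulSq_of_notMem (h.notMem_lattice hy)] at e
    have e2 : θ y ^ 2 * (α + β * L.weierstrassP y) = 0 := by linear_combination -e
    linear_combination (mul_eq_zero.mp e2).resolve_left (pow_ne_zero 2 hy)
  refine ⟨β, ?_, fun x => ?_⟩
  · have e := hαβ 0
    rw [zero_add, zero_sub, h.odd, h.map_zero, wpMulSq_of_mem (zero_mem _)] at e
    linear_combination -e
  · rw [hαβ x, hα]
    ring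

theorem deriv_zero_ne_zero (h : IsOddTheta L θ) : deriv θ 0 ≠ 0 := by
  obtain ⟨y, hy⟩ := h.exists_ne_zero
  obtain ⟨β, hβ, -⟩ := h.addition_aux hy
  intro h0
  rw [h0] at hβ
  simp [hy] at hβ

/-- The zeros of `θ` are the lattice points. -/
theorem ne_zero_iff (h : IsOddTheta L θ) {x : ℂ} : θ x ≠ 0 ↔ x ∉ L.lattice := by
  refine ⟨h.notMem_lattice, fun hx h0 => ?_⟩
  have e1 : ∀ᶠ y in 𝓝[≠] (0 : ℂ), θ (x + y) ≠ 0 :=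
    eventually_ne_zero_of_differentiable (f := fun y => θ (x + y))
      (h.differentiable.comp (differentiable_id.const_add x))
      (h.exists_ne_zero.imp' (fun z => z - x) fun z hz => by simpa using hz) 0
  have e2 : ∀ᶠ y in 𝓝[≠] (0 : ℂ), θ (x - y) ≠ 0 :=
    eventually_ne_zero_of_differentiable (f := fun y => θ (x - y))
      (h.differentiable.comp (differentiable_id.const_sub x))
      (h.exists_ne_zero.imp' (fun z => x - z) fun z hz => by simpa using hz) 0
  -- If `θ(x) = 0` off the lattice, the right side of the addition formula vanishes, while a generic
  -- `y` keeps the left side nonzero.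
  obtain ⟨y, ⟨hy1, hy2⟩, hy3⟩ := ((e1.and e2).and (h.eventually_ne_zero 0)).exists
  obtain ⟨β, -, hβ⟩ := h.addition_aux hy3
  have e := hβ x
  rw [wpMulSq_of_notMem hx, h0] at e
  simp [hy1, hy2] at e

/-- The addition formula for `θ`. -/
theorem addition_formula (h : IsOddTheta L θ) {x y : ℂ} (hx : θ x ≠ 0) (hy : θ y ≠ 0) :
    deriv θ 0 ^ 2 * (θ (x + y) * θ (x - y)) =
      -(θ x ^ 2 * θ y ^ 2 * (L.weierstrassP x - L.weierstrassP y)) := by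
  obtain ⟨β, hβ, e⟩ := h.addition_aux hy
  rw [e, wpMulSq_of_notMem (h.notMem_lattice hx)]
  linear_combination (θ x ^ 2 * (L.weierstrassP x - L.weierstrassP y)) * hβ

end IsOddTheta

/-! ### Differential equation of `℘` and addition of logarithmic derivatives -/

theorem isPreconnected_compl_lattice (L : PeriodPair) :
    IsPreconnected ((L.lattice : Set ℂ)ᶜ) := by
  have hc : (L.lattice : Set ℂ).Countable :=
    Set.countable_coe_iff.mp (inferInstanceAs (Countable L.lattice))
  exact (hc.isConnected_compl_of_one_lt_rank (by simp)).isPreconnected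

theorem hasDerivAt_weierstrassP (L : PeriodPair) {x : ℂ} (hx : x ∉ L.lattice) :
    HasDerivAt L.weierstrassP (L.derivWeierstrassP x) x := by
  rw [← L.deriv_weierstrassP]
  exact (L.analyticOnNhd_weierstrassP x hx).differentiableAt.hasDerivAt

/-- The second order differential equation `℘'' = 6 ℘² - g₂ / 2`. -/
theorem hasDerivAt_derivWeierstrassP (L : PeriodPair) {x : ℂ} (hx : x ∉ L.lattice) :
    HasDerivAt L.derivWeierstrassP (6 * L.weierstrassP x ^ 2 - L.g₂ / 2) x := by
  have hd : ∀ z ∉ L.lattice,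
      HasDerivAt L.derivWeierstrassP (deriv L.derivWeierstrassP z) z := fun z hz =>
    (L.analyticOnNhd_derivWeierstrassP z hz).differentiableAt.hasDerivAt
  -- Differentiating the first order equation gives the claim multiplied by `2℘'`; the factor is
  -- cancelled where `℘' ≠ 0`, and continuity covers its isolated zeros.
  have hprod : ∀ z ∉ L.lattice, L.derivWeierstrassP z *
      (deriv L.derivWeierstrassP z - (6 * L.weierstrassP z ^ 2 - L.g₂ / 2)) = 0 := by
    intro z hz
    have h1 := (hd z hz).pow 2
    have h2 := ((((hasDerivAt_weierstrassP L hz).pow 3).const_mul 4).sub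
      ((hasDerivAt_weierstrassP L hz).const_mul L.g₂)).sub_const L.g₃
    have hev : (fun w => L.derivWeierstrassP w ^ 2) =ᶠ[𝓝 z]
        fun w => 4 * L.weierstrassP w ^ 3 - L.g₂ * L.weierstrassP w - L.g₃ := by
      filter_upwards [L.isClosed_lattice.isOpen_compl.mem_nhds hz] with w hw
      exact L.derivWeierstrassP_sq w hw
    have e := h1.unique (h2.congr_of_eventuallyEq hev)
    push_cast at e
    linear_combination e / 2
  rcases (L.analyticOnNhd_derivWeierstrassP x hx).eventually_eq_zero_or_eventually_ne_zero with h | h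
  · exfalso
    have h0 := L.analyticOnNhd_derivWeierstrassP.eqOn_zero_of_preconnected_of_eventuallyEq_zero
      (isPreconnected_compl_lattice L) hx h
    obtain ⟨c, hc⟩ := L.isClosed_lattice.isOpen_compl.exists_is_const_of_deriv_eq_zero
      (isPreconnected_compl_lattice L) L.differentiableOn_weierstrassP
      (by rw [L.deriv_weierstrassP]; exact h0)
    refine not_eventually_const_weierstrassP L c ?_
    filter_upwards [eventually_notMem_lattice L 0] with z hz using hc z hz
  · have hca : ContinuousAt (deriv L.derivWeierstrassP) x :=
      (L.analyticOnNhd_derivWeierstrassP x hx).deriv.continuousAt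
    have hcb : ContinuousAt (fun z => 6 * L.weierstrassP z ^ 2 - L.g₂ / 2) x := by
      have := (L.analyticOnNhd_weierstrassP x hx).continuousAt
      fun_prop
    have hev : deriv L.derivWeierstrassP =ᶠ[𝓝[≠] x]
        fun z => 6 * L.weierstrassP z ^ 2 - L.g₂ / 2 := by
      filter_upwards [h, eventually_notMem_lattice L x] with z hz hzl
      exact sub_eq_zero.mp ((mul_eq_zero.mp (hprod z hzl)).resolve_left hz)
    have := ((hca.eventuallyEq_nhds_iff_eventuallyEq_nhdsNE hcb).mp hev).eq_of_nhds
    rw [← this]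
    exact hd x hx

namespace IsOddTheta

variable {L : PeriodPair} {θ : ℂ → ℂ}

theorem differentiableAt_logDeriv (h : IsOddTheta L θ) {x : ℂ} (hx : θ x ≠ 0) :
    DifferentiableAt ℂ (logDeriv θ) x := by
  have h1 := h.differentiable.analyticAt x
  exact (h1.deriv.div h1 hx).differentiableAt

theorem logDeriv_neg (h : IsOddTheta L θ) (x : ℂ) : logDeriv θ (-x) = -logDeriv θ x := by
  have hd : deriv θ (-x) = deriv θ x := by
    have e : (fun y => θ (-y)) = fun y => -θ y := funext h.odd
    have e2 := congrFun (congrArg deriv e) x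
    rw [deriv_comp_neg, deriv.fun_neg] at e2
    exact neg_inj.mp e2
  rw [logDeriv_apply, logDeriv_apply, hd, h.odd, div_neg]

theorem logDeriv_add_quasiPeriod (h : IsOddTheta L θ) {l B c : ℂ} (hB0 : B ≠ 0)
    (hB : ∀ x, θ (x + l) = B * cexp (c * x) * θ x) {x : ℂ} (hx : θ x ≠ 0) :
    logDeriv θ (x + l) = logDeriv θ x + c := by
  have hd1 : HasDerivAt (fun y => θ (y + l)) (deriv θ (x + l)) x :=
    (h.differentiable (x + l)).hasDerivAt.comp_add_const x l
  have hd2 : HasDerivAt (fun y => B * cexp (c * y) * θ y)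
      (B * (cexp (c * x) * c) * θ x + B * cexp (c * x) * deriv θ x) x := by
    have := ((((hasDerivAt_id x).const_mul c).cexp).const_mul B).mul
      (h.differentiable x).hasDerivAt
    exact this.congr_deriv (by simp)
  have e := (hd1.congr_of_eventuallyEq (Eventually.of_forall fun y => (hB y).symm)).unique hd2
  rw [logDeriv_apply, logDeriv_apply, e, hB]
  have := Complex.exp_ne_zero (c * x)
  field_simp
  ring

theorem eventually_ne_zero_nhds (h : IsOddTheta L θ) {x : ℂ} (hx : θ x ≠ 0) :
    ∀ᶠ z in 𝓝 x, θ z ≠ 0 :=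
  h.differentiable.continuous.continuousAt.eventually_ne hx

theorem weierstrassP_sub_ne_zero (h : IsOddTheta L θ) {x y : ℂ} (hx : θ x ≠ 0) (hy : θ y ≠ 0)
    (ha : θ (x + y) ≠ 0) (hs : θ (x - y) ≠ 0) : L.weierstrassP x - L.weierstrassP y ≠ 0 := by
  intro h0
  have e := h.addition_formula hx hy
  rw [h0] at e
  simp [h.deriv_zero_ne_zero, ha, hs] at e

/-- The logarithmic `x`-derivative of the addition formula. -/
theorem logDeriv_add_add_logDeriv_sub (h : IsOddTheta L θ) {x y : ℂ} (hx : θ x ≠ 0)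
    (hy : θ y ≠ 0) (ha : θ (x + y) ≠ 0) (hs : θ (x - y) ≠ 0) :
    logDeriv θ (x + y) + logDeriv θ (x - y) - 2 * logDeriv θ x =
      L.derivWeierstrassP x / (L.weierstrassP x - L.weierstrassP y) := by
  have hP := h.weierstrassP_sub_ne_zero hx hy ha hs
  have hev : (fun z => deriv θ 0 ^ 2 * (θ (z + y) * θ (z - y))) =ᶠ[𝓝 x] fun z =>
      -(θ z ^ 2 * θ y ^ 2 * (L.weierstrassP z - L.weierstrassP y)) := by
    filter_upwards [h.eventually_ne_zero_nhds hx] with z hz using h.addition_formula hz hy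
  have hd1 := (((h.differentiable (x + y)).hasDerivAt.comp_add_const x y).mul
    ((h.differentiable (x - y)).hasDerivAt.comp_sub_const x y)).const_mul (deriv θ 0 ^ 2)
  have hd2 := ((((h.differentiable x).hasDerivAt.pow 2).mul_const (θ y ^ 2)).mul
    ((hasDerivAt_weierstrassP L (h.notMem_lattice hx)).sub_const (L.weierstrassP y))).neg
  have e := hd1.unique (hd2.congr_of_eventuallyEq hev)
  have e0 := h.addition_formula hx hy
  simp only [logDeriv_apply]
  have hD := h.deriv_zero_ne_zero
  have hDab : deriv θ 0 ^ 2 * (θ (x + y) * θ (x - y)) ≠ 0 := by simp [hD, ha, hs]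
  refine mul_left_cancel₀ hDab ?_
  have l1 : deriv θ 0 ^ 2 * (θ (x + y) * θ (x - y)) *
      (deriv θ (x + y) / θ (x + y) + deriv θ (x - y) / θ (x - y) - 2 * (deriv θ x / θ x)) =
      deriv θ 0 ^ 2 * (deriv θ (x + y) * θ (x - y) + θ (x + y) * deriv θ (x - y)) -
        deriv θ 0 ^ 2 * (θ (x + y) * θ (x - y)) * (2 * (deriv θ x / θ x)) := by
    field_simp
  rw [l1, e, e0, Pi.pow_apply]
  field_simp
  ring

/-- Half the sum of the preceding relation and the one with `x` and `y` exchanged; by oddness the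
terms at `x - y` cancel. -/
theorem logDeriv_add_sub (h : IsOddTheta L θ) {x y : ℂ} (hx : θ x ≠ 0)
    (hy : θ y ≠ 0) (ha : θ (x + y) ≠ 0) (hs : θ (x - y) ≠ 0) :
    logDeriv θ (x + y) - logDeriv θ x - logDeriv θ y =
      (L.derivWeierstrassP x - L.derivWeierstrassP y) /
        (2 * (L.weierstrassP x - L.weierstrassP y)) := by
  have hP := h.weierstrassP_sub_ne_zero hx hy ha hs
  have e1 := h.logDeriv_add_add_logDeriv_sub hx hy ha hs
  have hs' : θ (y - x) ≠ 0 := by rw [← neg_sub, h.odd]; exact neg_ne_zero.mpr hs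
  have e2 := h.logDeriv_add_add_logDeriv_sub hy hx (by rwa [add_comm]) hs'
  rw [← neg_sub x y, h.logDeriv_neg, ← neg_sub (L.weierstrassP x), add_comm y x, div_neg] at e2
  have e3 : (L.derivWeierstrassP x - L.derivWeierstrassP y) /
        (2 * (L.weierstrassP x - L.weierstrassP y)) =
      (L.derivWeierstrassP x / (L.weierstrassP x - L.weierstrassP y) +
        -(L.derivWeierstrassP y / (L.weierstrassP x - L.weierstrassP y))) / 2 := by
    field_simp
    ring
  rw [e3, ← e1, ← e2]
  ring

/-- Differentiate the preceding quotient in `x`; the two differential equations of `℘` make the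
result polynomial in `℘` apart from the square. -/
theorem deriv_logDeriv_add_sub (h : IsOddTheta L θ) {x y : ℂ} (hx : θ x ≠ 0)
    (hy : θ y ≠ 0) (ha : θ (x + y) ≠ 0) (hs : θ (x - y) ≠ 0) :
    deriv (logDeriv θ) (x + y) - deriv (logDeriv θ) x =
      2 * L.weierstrassP x + L.weierstrassP y -
        (logDeriv θ (x + y) - logDeriv θ x - logDeriv θ y) ^ 2 := by
  have hP := h.weierstrassP_sub_ne_zero hx hy ha hs
  have hev : (fun z => logDeriv θ (z + y) - logDeriv θ z - logDeriv θ y) =ᶠ[𝓝 x] fun z =>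
      (L.derivWeierstrassP z - L.derivWeierstrassP y) /
        (2 * (L.weierstrassP z - L.weierstrassP y)) := by
    have c1 : ContinuousAt (fun z => θ (z + y)) x :=
      (h.differentiable.continuous.comp (continuous_add_const y)).continuousAt
    have c2 : ContinuousAt (fun z => θ (z - y)) x :=
      (h.differentiable.continuous.comp (continuous_id.sub continuous_const)).continuousAt
    filter_upwards [h.eventually_ne_zero_nhds hx, c1.eventually_ne ha, c2.eventually_ne hs]
      with z hz1 hz2 hz3 using h.logDeriv_add_sub hz1 hy hz2 hz3
  have hd1 := (((h.differentiableAt_logDeriv ha).hasDerivAt.comp_add_const x y).sub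
    (h.differentiableAt_logDeriv hx).hasDerivAt).sub_const (logDeriv θ y)
  have hxl := h.notMem_lattice hx
  have hd2 := ((hasDerivAt_derivWeierstrassP L hxl).sub_const (L.derivWeierstrassP y)).div
    (((hasDerivAt_weierstrassP L hxl).sub_const (L.weierstrassP y)).const_mul 2)
    (mul_ne_zero two_ne_zero hP)
  have e := hd1.unique (hd2.congr_of_eventuallyEq hev)
  rw [e, h.logDeriv_add_sub hx hy ha hs]
  have ox := L.derivWeierstrassP_sq x hxl
  have oy := L.derivWeierstrassP_sq y (h.notMem_lattice hy)
  have hP2 : (2 * (L.weierstrassP x - L.weierstrassP y)) ^ 2 ≠ 0 :=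
    pow_ne_zero 2 (mul_ne_zero two_ne_zero hP)
  rw [div_pow, div_eq_iff hP2, sub_mul (2 * L.weierstrassP x + L.weierstrassP y),
    div_mul_cancel₀ _ hP2]
  linear_combination oy - ox

/-- The left side of `deriv_logDeriv_add_sub` with `x` and `y` exchanged differs only in the
subtracted term, so comparison shows that `Λ' + ℘` agrees at `x` and `y`. -/
theorem exists_deriv_logDeriv (h : IsOddTheta L θ) :
    ∃ κ : ℂ, ∀ x, θ x ≠ 0 → deriv (logDeriv θ) x = -L.weierstrassP x - κ := by
  obtain ⟨x₀, hx₀⟩ := h.exists_ne_zero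
  refine ⟨-deriv (logDeriv θ) x₀ - L.weierstrassP x₀, fun x hx => ?_⟩
  have e1 : ∀ a, ∀ᶠ y in 𝓝[≠] (0 : ℂ), θ (a + y) ≠ 0 := fun a =>
    eventually_ne_zero_of_differentiable (f := fun y => θ (a + y))
      (h.differentiable.comp (differentiable_id.const_add a))
      (h.exists_ne_zero.imp' (fun z => z - a) fun z hz => by simpa using hz) 0
  have e2 : ∀ a, ∀ᶠ y in 𝓝[≠] (0 : ℂ), θ (a - y) ≠ 0 := fun a =>
    eventually_ne_zero_of_differentiable (f := fun y => θ (a - y))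
      (h.differentiable.comp (differentiable_id.const_sub a))
      (h.exists_ne_zero.imp' (fun z => a - z) fun z hz => by simpa using hz) 0
  have key : ∀ x y, θ x ≠ 0 → θ y ≠ 0 → θ (x + y) ≠ 0 → θ (x - y) ≠ 0 →
      deriv (logDeriv θ) x + L.weierstrassP x = deriv (logDeriv θ) y + L.weierstrassP y := by
    intro x y hx hy ha hs
    have k1 := h.deriv_logDeriv_add_sub hx hy ha hs
    have hs' : θ (y - x) ≠ 0 := by rw [← neg_sub, h.odd]; exact neg_ne_zero.mpr hs
    have k2 := h.deriv_logDeriv_add_sub hy hx (by rwa [add_comm]) hs'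
    rw [add_comm y x] at k2
    linear_combination k2 - k1
  -- An intermediate point `y` in general position with respect to both `x` and `x₀`, which may not
  -- be so with respect to each other.
  obtain ⟨y, ⟨⟨⟨hy1, hy2⟩, hy3⟩, hy4⟩, hy⟩ := (((((e1 x).and (e2 x)).and (e1 x₀)).and
    (e2 x₀)).and (h.eventually_ne_zero 0)).exists
  linear_combination key x y hx hy hy1 hy2 - key x₀ y hx₀ hy hy3 hy4

/-- The addition formula for the logarithmic derivative. -/
theorem sq_logDeriv_add_sub (h : IsOddTheta L θ) {x y : ℂ} (hx : θ x ≠ 0) (hy : θ y ≠ 0)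
    (ha : θ (x + y) ≠ 0) :
    (logDeriv θ x + logDeriv θ y - logDeriv θ (x + y)) ^ 2 =
      L.weierstrassP x + L.weierstrassP y + L.weierstrassP (x + y) := by
  obtain ⟨κ, hκ⟩ := h.exists_deriv_logDeriv
  -- The derivatives are replaced by `-℘ - κ` and `κ` cancels. The extra condition `θ(z - y) ≠ 0` is
  -- removed afterwards by continuity in `z`.
  have generic : ∀ z, θ z ≠ 0 → θ (z + y) ≠ 0 → θ (z - y) ≠ 0 →
      (logDeriv θ z + logDeriv θ y - logDeriv θ (z + y)) ^ 2 =
        L.weierstrassP z + L.weierstrassP y + L.weierstrassP (z + y) := by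
    intro z hz hza hzs
    have k := h.deriv_logDeriv_add_sub hz hy hza hzs
    rw [hκ _ hza, hκ _ hz] at k
    linear_combination k
  have c1 : ContinuousAt (fun z => θ (z + y)) x :=
    (h.differentiable.continuous.comp (continuous_add_const y)).continuousAt
  have e2 : ∀ᶠ z in 𝓝[≠] x, θ (z - y) ≠ 0 :=
    eventually_ne_zero_of_differentiable (f := fun z => θ (z - y))
      (h.differentiable.comp (differentiable_id.sub_const y))
      (h.exists_ne_zero.imp' (fun z => z + y) fun z hz => by simpa using hz) x
  have hev : (fun z => (logDeriv θ z + logDeriv θ y - logDeriv θ (z + y)) ^ 2) =ᶠ[𝓝[≠] x]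
      fun z => L.weierstrassP z + L.weierstrassP y + L.weierstrassP (z + y) := by
    filter_upwards [nhdsWithin_le_nhds (h.eventually_ne_zero_nhds hx),
      nhdsWithin_le_nhds (c1.eventually_ne ha), e2] with z h1 h2 h3 using generic z h1 h2 h3
  have hadd : ContinuousAt (fun z => z + y) x := (continuous_add_const y).continuousAt
  have d1 := (h.differentiableAt_logDeriv hx).continuousAt
  have d2 : ContinuousAt (fun z => logDeriv θ (z + y)) x :=
    ContinuousAt.comp (g := logDeriv θ) (h.differentiableAt_logDeriv ha).continuousAt hadd
  have d3 := (L.analyticOnNhd_weierstrassP x (h.notMem_lattice hx)).continuousAt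
  have d4 : ContinuousAt (fun z => L.weierstrassP (z + y)) x :=
    ContinuousAt.comp (g := L.weierstrassP)
      (L.analyticOnNhd_weierstrassP _ (h.notMem_lattice ha)).continuousAt hadd
  have l1 : ContinuousAt (fun z => (logDeriv θ z + logDeriv θ y - logDeriv θ (z + y)) ^ 2) x :=
    ((d1.add continuousAt_const).sub d2).pow 2
  have l2 : ContinuousAt
      (fun z => L.weierstrassP z + L.weierstrassP y + L.weierstrassP (z + y)) x :=
    (d3.add continuousAt_const).add d4
  exact ((l1.eventuallyEq_nhds_iff_eventuallyEq_nhdsNE l2).mp hev).eq_of_nhds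

end IsOddTheta

/-! ### The Weierstrass zeta function and the constant `η₁/ω₁` -/

/-- The three fractions combine to `s²/(l²(s - l))`, giving the cubic decay that is summable over a
lattice of rank two. -/
theorem norm_weierstrassZeta_term_le {r : ℝ} (hr : 0 < r) {s l : ℂ} (hs : ‖s‖ < r)
    (h : 2 * r ≤ ‖l‖) :
    ‖1 / (s - l) + 1 / l + s / l ^ 2‖ ≤ 2 * r ^ 2 * ‖l‖ ^ (-3 : ℝ) := by
  have hl : 0 < ‖l‖ := by linarith
  have hl0 : l ≠ 0 := norm_pos_iff.mp hl
  have hsl : ‖l‖ / 2 ≤ ‖s - l‖ := by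
    rw [norm_sub_rev]
    exact .trans (by linarith) (norm_sub_norm_le l s)
  have hsl0 : s - l ≠ 0 := norm_pos_iff.mp (by linarith)
  have e : 1 / (s - l) + 1 / l + s / l ^ 2 = s ^ 2 / (l ^ 2 * (s - l)) := by
    field_simp
    ring
  rw [e, norm_div, norm_mul, norm_pow, norm_pow]
  calc ‖s‖ ^ 2 / (‖l‖ ^ 2 * ‖s - l‖) ≤ r ^ 2 / (‖l‖ ^ 2 * (‖l‖ / 2)) := by gcongr
    _ = 2 * r ^ 2 / ‖l‖ ^ 3 := by field
    _ = _ := by rw [Real.rpow_neg hl.le]; norm_cast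

theorem hasSumLocallyUniformly_weierstrassZeta (L : PeriodPair) :
    HasSumLocallyUniformly
      (fun (l : L.lattice) (x : ℂ) => 1 / (x - l) + 1 / (l : ℂ) + x / (l : ℂ) ^ 2)
      (weierstrassZeta L) := by
  refine L.hasSumLocallyUniformly_aux (u := (2 * · ^ 2 * ‖·‖ ^ (-3 : ℝ))) _
    (fun _ _ ↦ (ZLattice.summable_norm_rpow _ _ (by simp; norm_num)).mul_left _) fun r hr ↦
    Filter.eventually_atTop.mpr ⟨2 * r, ?_⟩
  rintro _ h s hs l rfl
  exact norm_weierstrassZeta_term_le hr hs h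

theorem weierstrassZeta_neg (L : PeriodPair) (x : ℂ) :
    weierstrassZeta L (-x) = -weierstrassZeta L x := by
  unfold weierstrassZeta
  rw [← tsum_neg, ← (Equiv.neg L.lattice).tsum_eq]
  congr with l
  simp only [Equiv.neg_apply, NegMemClass.coe_neg]
  rw [show -x - -(l : ℂ) = -(x - l) by ring, neg_sq, div_neg, div_neg, neg_div]
  ring

/-- `ζ' = -℘`. -/
theorem hasDerivAt_weierstrassZeta (L : PeriodPair) {x : ℂ} (hx : x ∉ L.lattice) :
    HasDerivAt (weierstrassZeta L) (-L.weierstrassP x) x := by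
  have hopen : IsOpen ((L.lattice : Set ℂ)ᶜ) := L.isClosed_lattice.isOpen_compl
  have hterm : ∀ l : L.lattice, ∀ y ∉ L.lattice,
      HasDerivAt (fun y : ℂ => 1 / (y - l) + 1 / (l : ℂ) + y / (l : ℂ) ^ 2)
        (-(1 / (y - l) ^ 2 - 1 / (l : ℂ) ^ 2)) y := by
    intro l y hy
    have hne : y - l ≠ 0 := fun e => hy (by rw [sub_eq_zero.mp e]; exact l.2)
    have h1 := ((((hasDerivAt_id y).sub_const (l : ℂ)).inv hne).add_const (1 / (l : ℂ))).add
      ((hasDerivAt_id y).div_const ((l : ℂ) ^ 2))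
    refine (h1.congr_deriv ?_).congr_of_eventuallyEq (Eventually.of_forall fun z => ?_)
    · simp only [id]
      ring
    · simp
  have hu := (hasSumLocallyUniformly_weierstrassZeta L).tendstoLocallyUniformlyOn
    (s := ((L.lattice : Set ℂ)ᶜ))
  have hF : ∀ s : Finset L.lattice, ∀ y ∉ L.lattice,
      HasDerivAt (fun y : ℂ => ∑ l ∈ s, (1 / (y - l) + 1 / (l : ℂ) + y / (l : ℂ) ^ 2))
        (∑ l ∈ s, -(1 / (y - l) ^ 2 - 1 / (l : ℂ) ^ 2)) y :=
    fun s y hy => HasDerivAt.fun_sum fun l _ => hterm l y hy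
  have hFd : ∀ s : Finset L.lattice, DifferentiableOn ℂ
      (fun y : ℂ => ∑ l ∈ s, (1 / (y - l) + 1 / (l : ℂ) + y / (l : ℂ) ^ 2))
        ((L.lattice : Set ℂ)ᶜ) :=
    fun s y hy => (hF s y hy).differentiableAt.differentiableWithinAt
  have hdiff := (hu.differentiableOn (Eventually.of_forall hFd) hopen).differentiableAt
    (hopen.mem_nhds hx)
  have hlim := (hu.deriv (Eventually.of_forall hFd) hopen).tendsto_at hx
  have hlim2 : Tendsto (fun s : Finset L.lattice => ∑ l ∈ s, -(1 / (x - l) ^ 2 - 1 / (l : ℂ) ^ 2))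
      atTop (𝓝 (-L.weierstrassP x)) := (L.hasSum_weierstrassP x).neg
  have e : deriv (weierstrassZeta L) x = -L.weierstrassP x := by
    refine tendsto_nhds_unique (hlim.congr fun s => ?_) hlim2
    exact (hF s x hx).deriv
  rw [← e]
  exact hdiff.hasDerivAt

namespace IsOddTheta

variable {L : PeriodPair} {θ : ℂ → ℂ}

/-- On the connected complement of the lattice `Λ - ζ + κx` has derivative zero, so it is constant;
being odd, it vanishes. At `ω₁`, which is `L.ω₁ / 2`, `Λ` is zero because it is odd and has period
`2ω₁`. Hence `η₁ = κω₁`. -/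
theorem deriv_logDeriv (h : IsOddTheta L θ) {x : ℂ} (hx : θ x ≠ 0) :
    deriv (logDeriv θ) x = -L.weierstrassP x - eta1 L / halfPeriod L 1 := by
  obtain ⟨κ, hκ⟩ := h.exists_deriv_logDeriv
  suffices hs : κ = eta1 L / halfPeriod L 1 by rw [hκ x hx, hs]
  have hd : ∀ y ∉ L.lattice, HasDerivAt (fun y => logDeriv θ y - weierstrassZeta L y + κ * y)
      0 y := by
    intro y hy
    have h1 := (((h.differentiableAt_logDeriv (h.ne_zero_iff.mpr hy)).hasDerivAt.sub
      (hasDerivAt_weierstrassZeta L hy)).add ((hasDerivAt_id y).const_mul κ))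
    refine h1.congr_deriv ?_
    rw [hκ y (h.ne_zero_iff.mpr hy)]
    ring
  have h1 : L.ω₁ / 2 ∉ L.lattice := L.ω₁_div_two_notMem_lattice
  have h2 : -(L.ω₁ / 2) ∉ L.lattice := fun hc => h1 (by simpa using neg_mem hc)
  have e := L.isClosed_lattice.isOpen_compl.is_const_of_deriv_eq_zero
    (isPreconnected_compl_lattice L)
    (fun y hy => (hd y hy).differentiableAt.differentiableWithinAt)
    (fun y hy => (hd y hy).deriv) h1 h2
  simp only [h.logDeriv_neg, weierstrassZeta_neg] at e
  have e2 : logDeriv θ (L.ω₁ / 2) = 0 := by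
    have e3 := h.logDeriv_add_quasiPeriod (l := L.ω₁) (B := -1) (c := 0) (by simp)
      (fun x => by simp [h.add_omega1]) (h.ne_zero_iff.mpr h2)
    rw [show -(L.ω₁ / 2) + L.ω₁ = L.ω₁ / 2 by ring, h.logDeriv_neg, add_zero] at e3
    exact self_eq_neg.mp e3
  have hω := omega1_ne_zero L
  simp only [eta1, halfPeriod, Fin.isValue, Matrix.cons_val_one, Matrix.cons_val_zero]
  rw [e2] at e
  field_simp
  linear_combination e

end IsOddTheta

/-! ### Half-periods -/

/-- In coordinates counted in half-periods, lattice points have both entries even; the differences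
are checked to fail this. -/
theorem halfPeriod_sub_notMem_lattice (L : PeriodPair) {μ ν : Fin 4} (h : μ ≠ ν) :
    halfPeriod L μ - halfPeriod L ν ∉ L.lattice := by
  have key : ∀ m n : ℤ, ¬(2 ∣ m ∧ 2 ∣ n) → (m / 2 : ℂ) * L.ω₁ + (n / 2 : ℂ) * L.ω₂ ∉ L.lattice := by
    intro m n hmn hmem
    obtain ⟨a, b, hab⟩ := PeriodPair.mem_lattice.mp hmem
    apply hmn
    have hi := LinearIndependent.pair_iff.mp L.indep ((m : ℝ) - 2 * a) ((n : ℝ) - 2 * b) (by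
      simp only [Complex.real_smul]
      push_cast
      linear_combination -2 * hab)
    have h1 : (m : ℝ) = (2 * a : ℤ) := by push_cast; linarith [hi.1]
    have h2 : (n : ℝ) = (2 * b : ℤ) := by push_cast; linarith [hi.2]
    exact ⟨⟨a, by exact_mod_cast h1⟩, ⟨b, by exact_mod_cast h2⟩⟩
  have hrep : ∀ ν : Fin 4, halfPeriod L ν =
      ((![0, 1, -1, 0] : Fin 4 → ℤ) ν / 2 : ℂ) * L.ω₁ +
        ((![0, 0, -1, 1] : Fin 4 → ℤ) ν / 2 : ℂ) * L.ω₂ := by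
    intro ν
    fin_cases ν <;> simp [halfPeriod] <;> ring
  have e : halfPeriod L μ - halfPeriod L ν =
      (((![0, 1, -1, 0] : Fin 4 → ℤ) μ - (![0, 1, -1, 0] : Fin 4 → ℤ) ν : ℤ) / 2 : ℂ) * L.ω₁ +
        (((![0, 0, -1, 1] : Fin 4 → ℤ) μ - (![0, 0, -1, 1] : Fin 4 → ℤ) ν : ℤ) / 2 : ℂ) * L.ω₂ := by
    rw [hrep μ, hrep ν]
    push_cast
    ring
  rw [e]
  refine key _ _ ?_
  clear e
  revert h
  revert μ ν
  decide

/-- `c₀` in terms of the values of `℘` at differences of half-periods. -/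
theorem constc0_eq (L : PeriodPair) (g : Fin 4 → ℂ) :
    ∑ μ : Fin 4, ∑ ν ∈ Finset.Ioi μ,
      g μ * g ν * L.weierstrassP (halfPeriod L μ - halfPeriod L ν) = constc0 L g := by
  have h0 : halfPeriod L 0 = 0 := rfl
  -- The difference of two of `ω₁`, `ω₂`, `ω₃` is the third modulo the lattice, up to sign.
  have e12 : L.weierstrassP (halfPeriod L 1 - halfPeriod L 2) = eConst L 3 := by
    rw [show halfPeriod L 1 - halfPeriod L 2 = halfPeriod L 3 + L.ω₁ by
      simp [halfPeriod]; ring]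
    exact L.weierstrassP_add_coe _ ⟨L.ω₁, L.ω₁_mem_lattice⟩
  have e13 : L.weierstrassP (halfPeriod L 1 - halfPeriod L 3) = eConst L 2 := by
    rw [show halfPeriod L 1 - halfPeriod L 3 = halfPeriod L 2 + L.ω₁ by
      simp [halfPeriod]; ring]
    exact L.weierstrassP_add_coe _ ⟨L.ω₁, L.ω₁_mem_lattice⟩
  have e23 : L.weierstrassP (halfPeriod L 2 - halfPeriod L 3) = eConst L 1 := by
    rw [show halfPeriod L 2 - halfPeriod L 3 = -(halfPeriod L 1 + L.ω₂) by
      simp [halfPeriod]; ring, L.weierstrassP_neg]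
    exact L.weierstrassP_add_coe _ ⟨L.ω₂, L.ω₂_mem_lattice⟩
  have i0 : Finset.Ioi (0 : Fin 4) = {1, 2, 3} := by decide
  have i1 : Finset.Ioi (1 : Fin 4) = {2, 3} := by decide
  have i2 : Finset.Ioi (2 : Fin 4) = {3} := by decide
  have i3 : Finset.Ioi (3 : Fin 4) = ∅ := by decide
  rw [Fin.sum_univ_four, i0, i1, i2, i3, Finset.sum_insert (by decide),
    Finset.sum_insert (by decide), Finset.sum_singleton, Finset.sum_insert (by decide),
    Finset.sum_singleton, Finset.sum_singleton, Finset.sum_empty, e12, e13, e23, h0, zero_sub,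
    zero_sub, zero_sub, L.weierstrassP_neg, L.weierstrassP_neg, L.weierstrassP_neg, constc0,
    eConst, eConst, eConst]
  ring

theorem two_mul_halfPeriod_mem_lattice (L : PeriodPair) (ν : Fin 4) :
    2 * halfPeriod L ν ∈ L.lattice := by
  have h1 := L.ω₁_mem_lattice
  have h2 := L.ω₂_mem_lattice
  fin_cases ν
  · simp [halfPeriod]
  · simpa [halfPeriod, mul_div_cancel₀] using h1
  · have := sub_mem (neg_mem h1) h2
    rw [show -L.ω₁ - L.ω₂ = 2 * (-(L.ω₁ / 2) - L.ω₂ / 2) by ring] at this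
    simpa [halfPeriod] using this
  · simpa [halfPeriod, mul_div_cancel₀] using h2

theorem weierstrassP_neg_add_halfPeriod (L : PeriodPair) (ν : Fin 4) (y : ℂ) :
    L.weierstrassP (-y + halfPeriod L ν) = L.weierstrassP (y + halfPeriod L ν) := by
  rw [← L.weierstrassP_neg, show -(-y + halfPeriod L ν) =
    y + halfPeriod L ν - 2 * halfPeriod L ν by ring]
  exact L.weierstrassP_sub_coe _ ⟨_, two_mul_halfPeriod_mem_lattice L ν⟩

/-! ### Logarithmic derivatives of the four theta functions -/

section

variable {ω₁ β : ℂ}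

theorem omega_ne_zero_of_im_pos (hβ : 0 < (tau ω₁ β).im) : ω₁ ≠ 0 := by
  rintro rfl
  simp [tau] at hβ

theorem omega3_eq (hβ : 0 < (tau ω₁ β).im) : omega3 ω₁ β = tau ω₁ β * ω₁ := by
  have := omega_ne_zero_of_im_pos hβ
  unfold tau omega3
  field_simp

/-- Since `θ₁` must not vanish identically, a point where it is nonzero is supplied; each
application has one at hand. -/
theorem isOddTheta_theta (hβ : 0 < (tau ω₁ β).im) {x₀ : ℂ} (hx₀ : theta ω₁ (tau ω₁ β) 0 x₀ ≠ 0) :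
    IsOddTheta (periods ω₁ β hβ) (theta ω₁ (tau ω₁ β) 0) where
  differentiable := differentiable_theta hβ 0
  odd := theta_zero_neg hβ
  add_omega1 := theta_zero_add_two_omega1 (omega_ne_zero_of_im_pos hβ) hβ
  add_omega2 := by
    refine ⟨-cexp (-π * I * tau ω₁ β), by simp, fun x => ?_⟩
    have h := theta_zero_add_two_omega3 (omega_ne_zero_of_im_pos hβ) hβ x
    rw [← omega3_eq hβ] at h
    exact h
  exists_ne_zero := ⟨x₀, hx₀⟩

theorem halfPeriod_periods (hβ : 0 < (tau ω₁ β).im) (ν : Fin 4) :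
    halfPeriod (periods ω₁ β hβ) ν =
      (![0, ω₁, -ω₁ - tau ω₁ β * ω₁, tau ω₁ β * ω₁] : Fin 4 → ℂ) ν := by
  rw [← omega3_eq hβ]
  fin_cases ν <;> simp [halfPeriod, periods]

theorem theta_ne_zero_iff_halfPeriod (hβ : 0 < (tau ω₁ β).im) (ν : Fin 4) (x : ℂ) :
    theta ω₁ (tau ω₁ β) ν x ≠ 0 ↔
      theta ω₁ (tau ω₁ β) 0 (x + halfPeriod (periods ω₁ β hβ) ν) ≠ 0 := by
  obtain ⟨c, hc, h⟩ := exists_theta_eq_theta_zero (omega_ne_zero_of_im_pos hβ) hβ ν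
  rw [h x, halfPeriod_periods]
  simp [hc]

theorem logDeriv_theta (hβ : 0 < (tau ω₁ β).im) (ν : Fin 4) {x : ℂ}
    (hx : theta ω₁ (tau ω₁ β) ν x ≠ 0) :
    logDeriv (theta ω₁ (tau ω₁ β) ν) x =
      logDeriv (theta ω₁ (tau ω₁ β) 0) (x + halfPeriod (periods ω₁ β hβ) ν) +
        shiftExponent ω₁ ν := by
  rw [theta_ne_zero_iff_halfPeriod hβ] at hx
  obtain ⟨c, hc, h⟩ := exists_theta_eq_theta_zero (omega_ne_zero_of_im_pos hβ) hβ ν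
  rw [← halfPeriod_periods hβ] at h
  set w := halfPeriod (periods ω₁ β hβ) ν
  have hd2 : HasDerivAt (fun y => c * cexp (shiftExponent ω₁ ν * y) *
        theta ω₁ (tau ω₁ β) 0 (y + w))
      (c * (cexp (shiftExponent ω₁ ν * x) * shiftExponent ω₁ ν) * theta ω₁ (tau ω₁ β) 0 (x + w) +
        c * cexp (shiftExponent ω₁ ν * x) * deriv (theta ω₁ (tau ω₁ β) 0) (x + w)) x := by
    have := ((((hasDerivAt_id x).const_mul (shiftExponent ω₁ ν)).cexp).const_mul c).mul
      ((differentiable_theta (ω₁ := ω₁) hβ 0 (x + w)).hasDerivAt.comp_add_const x w)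
    exact this.congr_deriv (by simp)
  rw [logDeriv_apply, logDeriv_apply, funext h, hd2.deriv]
  have := Complex.exp_ne_zero (shiftExponent ω₁ ν * x)
  field_simp
  ring

theorem logDeriv_theta_neg (hβ : 0 < (tau ω₁ β).im) (ν : Fin 4) (x : ℂ) :
    logDeriv (theta ω₁ (tau ω₁ β) ν) (-x) = -logDeriv (theta ω₁ (tau ω₁ β) ν) x := by
  by_cases hν : ν = 0
  · subst hν
    have hd : deriv (theta ω₁ (tau ω₁ β) 0) (-x) = deriv (theta ω₁ (tau ω₁ β) 0) x := by
      have e2 := congrFun (congrArg deriv (funext (theta_zero_neg (ω₁ := ω₁) hβ))) x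
      rw [deriv_comp_neg, deriv.fun_neg] at e2
      exact neg_inj.mp e2
    rw [logDeriv_apply, logDeriv_apply, hd, theta_zero_neg hβ, div_neg]
  · have hd : deriv (theta ω₁ (tau ω₁ β) ν) (-x) = -deriv (theta ω₁ (tau ω₁ β) ν) x := by
      have e2 := congrFun (congrArg deriv (funext (theta_neg (ω₁ := ω₁) hβ hν))) x
      rw [deriv_comp_neg] at e2
      exact neg_eq_iff_eq_neg.mp e2
    rw [logDeriv_apply, logDeriv_apply, hd, theta_neg hβ hν, neg_div]

/-- The quasi-periodicity of the logarithmic derivative of `θ₁`. -/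
theorem logDeriv_theta_zero_add (hβ : 0 < (tau ω₁ β).im) (ν : Fin 4) {x : ℂ}
    (hx : theta ω₁ (tau ω₁ β) 0 x ≠ 0) :
    logDeriv (theta ω₁ (tau ω₁ β) 0) (x + 2 * halfPeriod (periods ω₁ β hβ) ν) =
      logDeriv (theta ω₁ (tau ω₁ β) 0) x - 2 * shiftExponent ω₁ ν := by
  set w := halfPeriod (periods ω₁ β hβ) ν with hw
  -- The shift relation is applied at `x + w` and at `-(x + w)`; parity of `θ_{ν+1}` links the two.
  have h1 : theta ω₁ (tau ω₁ β) ν (-(x + w)) ≠ 0 := by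
    rw [theta_ne_zero_iff_halfPeriod hβ, ← hw, neg_add_rev, neg_add_cancel_comm, theta_zero_neg hβ]
    exact neg_ne_zero.mpr hx
  have h2 : theta ω₁ (tau ω₁ β) ν (x + w) ≠ 0 := by
    by_cases hν : ν = 0
    · subst hν
      rw [theta_zero_neg hβ] at h1
      exact neg_ne_zero.mp h1
    · rwa [theta_neg hβ hν] at h1
  have e1 := logDeriv_theta hβ ν h1
  have e2 := logDeriv_theta hβ ν h2
  rw [← hw] at e1 e2
  rw [logDeriv_theta_neg hβ, neg_add_rev, neg_add_cancel_comm, logDeriv_theta_neg hβ] at e1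
  rw [show x + 2 * w = x + w + w by ring]
  linear_combination -e1 - e2

/-- The derivative of the logarithmic derivative of a theta function. -/
theorem deriv_logDeriv_theta (hβ : 0 < (tau ω₁ β).im) (ν : Fin 4) {x : ℂ}
    (hx : theta ω₁ (tau ω₁ β) ν x ≠ 0) :
    deriv (logDeriv (theta ω₁ (tau ω₁ β) ν)) x =
      -(periods ω₁ β hβ).weierstrassP (x + halfPeriod (periods ω₁ β hβ) ν) -
        eta1 (periods ω₁ β hβ) / halfPeriod (periods ω₁ β hβ) 1 := by
  have hev : logDeriv (theta ω₁ (tau ω₁ β) ν) =ᶠ[𝓝 x] fun y =>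
      logDeriv (theta ω₁ (tau ω₁ β) 0) (y + halfPeriod (periods ω₁ β hβ) ν) +
        shiftExponent ω₁ ν := by
    filter_upwards [(differentiable_theta hβ ν).continuous.continuousAt.eventually_ne hx]
      with y hy using logDeriv_theta hβ ν hy
  have hx' := (theta_ne_zero_iff_halfPeriod hβ ν x).mp hx
  have h := isOddTheta_theta hβ hx'
  rw [hev.deriv_eq, deriv_add_const, deriv_comp_add_const, h.deriv_logDeriv hx']

/-- The addition formula for the logarithmic derivatives of the theta functions. -/
theorem sq_logDeriv_theta_add_sub (hβ : 0 < (tau ω₁ β).im) (ν : Fin 4) {x y : ℂ}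
    (hx : theta ω₁ (tau ω₁ β) ν x ≠ 0) (hy : theta ω₁ (tau ω₁ β) ν y ≠ 0)
    (ha : theta ω₁ (tau ω₁ β) 0 (x + y) ≠ 0) :
    (logDeriv (theta ω₁ (tau ω₁ β) ν) x + logDeriv (theta ω₁ (tau ω₁ β) ν) y -
        logDeriv (theta ω₁ (tau ω₁ β) 0) (x + y)) ^ 2 =
      (periods ω₁ β hβ).weierstrassP (x + halfPeriod (periods ω₁ β hβ) ν) +
        (periods ω₁ β hβ).weierstrassP (y + halfPeriod (periods ω₁ β hβ) ν) +
        (periods ω₁ β hβ).weierstrassP (x + y) := by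
  have h := isOddTheta_theta hβ ha
  have hx' := (theta_ne_zero_iff_halfPeriod hβ ν x).mp hx
  have hy' := (theta_ne_zero_iff_halfPeriod hβ ν y).mp hy
  have e3 := logDeriv_theta_zero_add hβ ν ha
  have e1 := logDeriv_theta hβ ν hx
  have e2 := logDeriv_theta hβ ν hy
  set L := periods ω₁ β hβ
  set w := halfPeriod L ν with hw
  have hl : 2 * w ∈ L.lattice := two_mul_halfPeriod_mem_lattice L ν
  have hsum : x + w + (y + w) = x + y + 2 * w := by ring
  have ha' : theta ω₁ (tau ω₁ β) 0 (x + w + (y + w)) ≠ 0 := by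
    rw [hsum, h.ne_zero_iff]
    intro hm
    exact h.ne_zero_iff.mp ha (by simpa using sub_mem hm hl)
  have e := h.sq_logDeriv_add_sub hx' hy' ha'
  rw [hsum, e3, L.weierstrassP_add_coe _ ⟨2 * w, hl⟩] at e
  -- The two constants `shiftExponent ω₁ ν` from `x` and `y` cancel against the increment over the
  -- quasi-period `2w`.
  rw [e1, e2, ← e]
  ring

theorem sq_logDeriv_theta_sub_sub (hβ : 0 < (tau ω₁ β).im) (ν : Fin 4) {x y : ℂ}
    (hx : theta ω₁ (tau ω₁ β) ν x ≠ 0) (hy : theta ω₁ (tau ω₁ β) ν y ≠ 0)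
    (hs : theta ω₁ (tau ω₁ β) 0 (x - y) ≠ 0) :
    (logDeriv (theta ω₁ (tau ω₁ β) ν) x - logDeriv (theta ω₁ (tau ω₁ β) ν) y -
        logDeriv (theta ω₁ (tau ω₁ β) 0) (x - y)) ^ 2 =
      (periods ω₁ β hβ).weierstrassP (x + halfPeriod (periods ω₁ β hβ) ν) +
        (periods ω₁ β hβ).weierstrassP (y + halfPeriod (periods ω₁ β hβ) ν) +
        (periods ω₁ β hβ).weierstrassP (x - y) := by
  have hy' : theta ω₁ (tau ω₁ β) ν (-y) ≠ 0 := by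
    by_cases hν : ν = 0
    · subst hν
      rw [theta_zero_neg hβ]
      exact neg_ne_zero.mpr hy
    · rwa [theta_neg hβ hν]
  have e := sq_logDeriv_theta_add_sub hβ ν hx hy' (by rwa [← sub_eq_add_neg])
  rwa [logDeriv_theta_neg hβ, weierstrassP_neg_add_halfPeriod, ← sub_eq_add_neg,
    ← sub_eq_add_neg] at e

/-- The difference formula for the logarithmic derivatives of two theta functions. -/
theorem sq_logDeriv_theta_sub (hβ : 0 < (tau ω₁ β).im) {μ ν : Fin 4} (hμν : μ ≠ ν) {x : ℂ}
    (hμ : theta ω₁ (tau ω₁ β) μ x ≠ 0) (hν : theta ω₁ (tau ω₁ β) ν x ≠ 0) :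
    (logDeriv (theta ω₁ (tau ω₁ β) μ) x - logDeriv (theta ω₁ (tau ω₁ β) ν) x) ^ 2 =
      (periods ω₁ β hβ).weierstrassP (x + halfPeriod (periods ω₁ β hβ) μ) +
        (periods ω₁ β hβ).weierstrassP (x + halfPeriod (periods ω₁ β hβ) ν) +
        (periods ω₁ β hβ).weierstrassP
          (halfPeriod (periods ω₁ β hβ) μ - halfPeriod (periods ω₁ β hβ) ν) := by
  have hμ' := (theta_ne_zero_iff_halfPeriod hβ μ x).mp hμ
  have hν' := (theta_ne_zero_iff_halfPeriod hβ ν x).mp hν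
  have h := isOddTheta_theta hβ hμ'
  have e1 := logDeriv_theta hβ μ hμ
  have e2 := logDeriv_theta hβ ν hν
  have hmem := halfPeriod_sub_notMem_lattice (periods ω₁ β hβ) hμν
  have q1 := fun z hz => logDeriv_theta_zero_add hβ μ (x := z) hz
  have q2 := fun z hz => logDeriv_theta_zero_add hβ ν (x := z) hz
  set L := periods ω₁ β hβ
  set a := halfPeriod L μ
  set b := halfPeriod L ν
  have hd : theta ω₁ (tau ω₁ β) 0 (a - b) ≠ 0 := h.ne_zero_iff.mpr hmem
  have hd' : theta ω₁ (tau ω₁ β) 0 (b - a) ≠ 0 := by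
    rw [← neg_sub, h.odd]; exact neg_ne_zero.mpr hd
  -- Since `b - a + 2a = a - b + 2b`, two uses of quasi-periodicity and oddness give this value. The
  -- three-term relation is then used at `x + a` and `-(x + b)`.
  have e3 : logDeriv (theta ω₁ (tau ω₁ β) 0) (a - b) = shiftExponent ω₁ ν - shiftExponent ω₁ μ := by
    have k1 := q1 _ hd'
    have k2 := q2 _ hd
    rw [show b - a + 2 * a = a - b + 2 * b by ring, k2, ← neg_sub a b, h.logDeriv_neg] at k1
    linear_combination k1 / 2
  have hneg : theta ω₁ (tau ω₁ β) 0 (-(x + b)) ≠ 0 := by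
    rw [h.odd]; exact neg_ne_zero.mpr hν'
  have hsum : x + a + -(x + b) = a - b := by ring
  have e := h.sq_logDeriv_add_sub hμ' hneg (by rwa [hsum])
  rw [hsum, h.logDeriv_neg, L.weierstrassP_neg, e3] at e
  rw [e1, e2, ← e]
  ring

end

/-! ### The algebraic identity -/

section Algebra

theorem sum_eq_zero_of_antisymm {ι : Type*} [Fintype ι] {f : ι → ι → ℂ}
    (h : ∀ j k, f k j = -f j k) : ∑ j, ∑ k, f j k = 0 := by
  have e : ∑ j, ∑ k, f j k = -∑ j, ∑ k, f j k := by
    conv_lhs => rw [Finset.sum_comm]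
    simp only [← Finset.sum_neg_distrib]
    exact Finset.sum_congr rfl fun j _ => Finset.sum_congr rfl fun k _ => h j k
  exact self_eq_neg.mp e

/-- Each product `2 a_μ a_ν` is `a_μ² + a_ν²` minus values of `℘`. Collecting squares, `a_μ²`
receives `g_μ` times the sum of all `g_ν`, which is how `|g|` enters. -/
theorem sq_sum_four (g a p : Fin 4 → ℂ) (e : Fin 4 → Fin 4 → ℂ)
    (h : ∀ μ ν, μ ≠ ν → (a μ - a ν) ^ 2 = p μ + p ν + e μ ν) :
    (∑ ν, g ν * a ν) ^ 2 = absG g * ∑ ν, g ν * a ν ^ 2 - absG g * ∑ ν, g ν * p ν +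
      ∑ ν, g ν ^ 2 * p ν - ∑ μ : Fin 4, ∑ ν ∈ Finset.Ioi μ, g μ * g ν * e μ ν := by
  have i0 : Finset.Ioi (0 : Fin 4) = {1, 2, 3} := by decide
  have i1 : Finset.Ioi (1 : Fin 4) = {2, 3} := by decide
  have i2 : Finset.Ioi (2 : Fin 4) = {3} := by decide
  have i3 : Finset.Ioi (3 : Fin 4) = ∅ := by decide
  simp only [Fin.sum_univ_four, i0, i1, i2, i3, absG]
  rw [Finset.sum_insert (by decide), Finset.sum_insert (by decide), Finset.sum_singleton,
    Finset.sum_insert (by decide), Finset.sum_singleton, Finset.sum_singleton, Finset.sum_empty]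
  linear_combination -(g 0 * g 1) * h 0 1 (by decide) - g 0 * g 2 * h 0 2 (by decide) -
    g 0 * g 3 * h 0 3 (by decide) - g 1 * g 2 * h 1 2 (by decide) -
    g 1 * g 3 * h 1 3 (by decide) - g 2 * g 3 * h 2 3 (by decide)

variable {ι : Type*} [Fintype ι] [DecidableEq ι]

/-- Symmetrising in `j`, `k` gives `u(a_j - a_k) + v(a_j + a_k)`. The two hypotheses express these
products by squares, and adding them cancels `a_j a_k`. -/
theorem sum_mul_pair {a p : ι → ℂ} {u v m s : ι → ι → ℂ}
    (hu : ∀ j k, u k j = -u j k) (hv : ∀ j k, v k j = v j k)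
    (hu0 : ∀ j, u j j = 0) (hv0 : ∀ j, v j j = 0) (hm0 : ∀ j, m j j = 0) (hs0 : ∀ j, s j j = 0)
    (hm : ∀ j k, j ≠ k → (a j - a k - u j k) ^ 2 = p j + p k + m j k)
    (hs : ∀ j k, j ≠ k → (a j + a k - v j k) ^ 2 = p j + p k + s j k) :
    ∑ j, a j * ∑ k, (u j k + v j k) = ((Fintype.card ι : ℂ) - 1) * ∑ j, (a j ^ 2 - p j) +
      (∑ j, ∑ k, (u j k ^ 2 + v j k ^ 2 - m j k - s j k)) / 4 := by
  have h1 : ∑ j, a j * ∑ k, (u j k + v j k) = ∑ j, ∑ k, a j * (u j k + v j k) := by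
    simp only [Finset.mul_sum]
  have h2 : ∑ j, ∑ k, a j * (u j k + v j k) = ∑ j, ∑ k, a k * (u k j + v k j) :=
    Finset.sum_comm
  -- On the diagonal the left side is zero, so the `if` removes what the formula would give there.
  have h3 : ∀ j k, a j * (u j k + v j k) + a k * (u k j + v k j) =
      (a j ^ 2 - p j) + (a k ^ 2 - p k) + (u j k ^ 2 + v j k ^ 2 - m j k - s j k) / 2 -
        if j = k then 2 * (a j ^ 2 - p j) else 0 := by
    intro j k
    by_cases hjk : j = k
    · subst hjk
      rw [if_pos rfl, hu0, hv0, hm0, hs0]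
      ring
    · rw [if_neg hjk, hu j k, hv j k]
      linear_combination (-1 / 2) * hm j k hjk - (1 / 2) * hs j k hjk
  have h4 : 2 * ∑ j, ∑ k, a j * (u j k + v j k) =
      ∑ j, ∑ k, ((a j ^ 2 - p j) + (a k ^ 2 - p k) +
        (u j k ^ 2 + v j k ^ 2 - m j k - s j k) / 2 -
        if j = k then 2 * (a j ^ 2 - p j) else 0) := by
    rw [two_mul]
    nth_rewrite 2 [h2]
    simp only [← Finset.sum_add_distrib, h3]
  have h5 : ∑ j, ∑ k, ((a j ^ 2 - p j) + (a k ^ 2 - p k) +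
        (u j k ^ 2 + v j k ^ 2 - m j k - s j k) / 2 -
        if j = k then 2 * (a j ^ 2 - p j) else 0) =
      Fintype.card ι * ∑ j, (a j ^ 2 - p j) + Fintype.card ι * ∑ j, (a j ^ 2 - p j) +
        (∑ j, ∑ k, (u j k ^ 2 + v j k ^ 2 - m j k - s j k)) / 2 - 2 * ∑ j, (a j ^ 2 - p j) := by
    rw [Finset.sum_congr rfl fun j _ => Finset.sum_sub_distrib .., Finset.sum_sub_distrib,
      Finset.sum_congr rfl fun j _ => Finset.sum_add_distrib, Finset.sum_add_distrib,
      Finset.sum_congr rfl fun j _ => Finset.sum_add_distrib, Finset.sum_add_distrib]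
    simp only [Finset.sum_const, Finset.card_univ, nsmul_eq_mul, Finset.sum_ite_eq,
      Finset.mem_univ, if_true, ← Finset.mul_sum, ← Finset.sum_div]
  rw [h1]
  linear_combination (h4.trans h5) / 2

/-- The products `t_jk t_jl` with distinct indices are summed cyclically and become sums of `q`; the
factor `n - 2` counts the third index. For `k = l` the mixed part `2uv` is antisymmetric and sums to
zero. -/
theorem sum_sq_triple {u v m s : ι → ι → ℂ}
    (hu : ∀ j k, u k j = -u j k) (hv : ∀ j k, v k j = v j k) (hm : ∀ j k, m k j = m j k)
    (hs : ∀ j k, s k j = s j k)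
    (hu0 : ∀ j, u j j = 0) (hv0 : ∀ j, v j j = 0) (hm0 : ∀ j, m j j = 0) (hs0 : ∀ j, s j j = 0)
    (h4 : ∀ j k l, j ≠ k → k ≠ l → j ≠ l →
      (u j k + u k l - u j l) ^ 2 = m j k + m k l + m j l)
    (h5 : ∀ j k l, j ≠ k → k ≠ l → j ≠ l →
      (u j k + v k l - v j l) ^ 2 = m j k + s k l + s j l) :
    ∑ j, (∑ k, (u j k + v j k)) ^ 2 = ∑ j, ∑ k, (u j k ^ 2 + v j k ^ 2) +
      ((Fintype.card ι : ℂ) - 2) * ∑ j, ∑ k, (u j k ^ 2 + v j k ^ 2 - m j k - s j k) := by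
  set t : ι → ι → ℂ := fun j k => u j k + v j k with ht
  set q : ι → ι → ℂ := fun j k => u j k ^ 2 + v j k ^ 2 - m j k - s j k with hq
  have ht0 : ∀ j, t j j = 0 := fun j => by simp [ht, hu0, hv0]
  have hq0 : ∀ j, q j j = 0 := fun j => by simp [hq, hu0, hv0, hm0, hs0]
  have hqs : ∀ j k, q k j = q j k := fun j k => by
    simp only [hq, hu j k, hv j k, hm j k, hs j k]
    ring
  have e1 : ∑ j, (∑ k, t j k) ^ 2 = ∑ j, ∑ k, ∑ l, t j k * t j l := by
    simp only [sq, Finset.sum_mul_sum]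
  have e2 : ∑ j, ∑ k, ∑ l, t j k * t j l = ∑ j, ∑ k, ∑ l, t k l * t k j := by
    rw [Finset.sum_comm]
    refine Finset.sum_congr rfl fun k _ => Finset.sum_congr rfl fun j _ =>
      Finset.sum_congr rfl fun l _ => ?_
    ring
  have e3 : ∑ j, ∑ k, ∑ l, t j k * t j l = ∑ j, ∑ k, ∑ l, t l j * t l k := by
    refine Eq.trans (Finset.sum_comm (f := fun l j => ∑ k, t l j * t l k)) ?_
    exact Finset.sum_congr rfl fun j _ => Finset.sum_comm
  -- The `if` terms correct for coinciding indices, where only one square survives on the left.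
  have pt : ∀ j k l, t j k * t j l + t k l * t k j + t l j * t l k =
      q j k + q k l + q j l + (if j = k then t l j ^ 2 - 2 * q l j else 0) +
        (if k = l then t j k ^ 2 - 2 * q j k else 0) +
        (if j = l then t k j ^ 2 - 2 * q k j else 0) := by
    intro j k l
    by_cases hjk : j = k
    · subst hjk
      by_cases hjl : j = l
      · subst hjl
        simp [ht0, hq0]
      · simp only [if_true, if_neg hjl, ht0, hq0, hqs j l]
        ring
    · by_cases hkl : k = l
      · subst hkl
        simp only [if_true, if_neg hjk, ht0, hq0]
        ring
      · by_cases hjl : j = l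
        · subst hjl
          simp only [if_true, if_neg hjk, if_neg hkl, ht0, hq0, hqs j k]
          ring
        · simp only [if_neg hjk, if_neg hkl, if_neg hjl]
          have r1 := h4 j k l hjk hkl hjl
          have r2 := h5 j k l hjk hkl hjl
          have r3 := h5 k l j hkl (Ne.symm hjl) (Ne.symm hjk)
          have r4 := h5 j l k hjl (Ne.symm hkl) hjk
          simp only [ht, hq, hu j k, hu k l, hu j l, hv j k, hv k l, hv j l,
            hs j k, hs k l, hs j l] at r1 r2 r3 r4 ⊢
          -- In these four relations every `u` and every `v` is squared twice, and the cross terms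
          -- add up to the cyclic sum of `t t`.
          linear_combination (-1 / 2) * (r1 + r2 + r3 + r4)
  have e4 : 3 * ∑ j, ∑ k, ∑ l, t j k * t j l = ∑ j, ∑ k, ∑ l, (q j k + q k l + q j l +
        (if j = k then t l j ^ 2 - 2 * q l j else 0) +
        (if k = l then t j k ^ 2 - 2 * q j k else 0) +
        (if j = l then t k j ^ 2 - 2 * q k j else 0)) := by
    rw [show ∀ z : ℂ, 3 * z = z + z + z from fun z => by ring]
    nth_rewrite 2 [e2]
    nth_rewrite 2 [e3]
    simp only [← Finset.sum_add_distrib, pt]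
  have e5 : ∑ j, ∑ k, ∑ l, (q j k + q k l + q j l +
        (if j = k then t l j ^ 2 - 2 * q l j else 0) +
        (if k = l then t j k ^ 2 - 2 * q j k else 0) +
        (if j = l then t k j ^ 2 - 2 * q k j else 0)) =
      3 * (Fintype.card ι * ∑ j, ∑ k, q j k) + 3 * ∑ j, ∑ k, (t j k ^ 2 - 2 * q j k) := by
    have f1 : ∑ j, ∑ k, ∑ l : ι, (if j = k then t l j ^ 2 - 2 * q l j else 0) =
        ∑ j, ∑ k, (t j k ^ 2 - 2 * q j k) := by
      rw [Finset.sum_comm]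
      rw [Finset.sum_congr rfl fun k _ => Finset.sum_comm]
      simp only [Finset.sum_ite_eq', Finset.mem_univ, if_true]
      exact Finset.sum_comm
    have f2 : ∑ j, ∑ k, ∑ l, (if k = l then t j k ^ 2 - 2 * q j k else 0) =
        ∑ j, ∑ k, (t j k ^ 2 - 2 * q j k) := by
      simp only [Finset.sum_ite_eq, Finset.mem_univ, if_true]
    have f3 : ∑ j, ∑ k, ∑ l, (if j = l then t k j ^ 2 - 2 * q k j else 0) =
        ∑ j, ∑ k, (t j k ^ 2 - 2 * q j k) := by
      simp only [Finset.sum_ite_eq, Finset.mem_univ, if_true]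
      exact Finset.sum_comm
    have f4 : ∑ j, ∑ k, ∑ _l : ι, q j k = Fintype.card ι * ∑ j, ∑ k, q j k := by
      simp only [Finset.sum_const, Finset.card_univ, nsmul_eq_mul, Finset.mul_sum]
    have f5 : ∑ _j : ι, ∑ k, ∑ l, q k l = Fintype.card ι * ∑ j, ∑ k, q j k := by
      simp only [Finset.sum_const, Finset.card_univ, nsmul_eq_mul]
    have f6 : ∑ j, ∑ _k : ι, ∑ l, q j l = Fintype.card ι * ∑ j, ∑ k, q j k := by
      simp only [Finset.sum_const, Finset.card_univ, nsmul_eq_mul, Finset.mul_sum]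
    simp only [Finset.sum_add_distrib]
    rw [f1, f2, f3, f4, f5, f6]
    ring
  have e6 : ∑ j, ∑ k, (t j k ^ 2 - 2 * q j k) =
      ∑ j, ∑ k, (u j k ^ 2 + v j k ^ 2) - 2 * ∑ j, ∑ k, q j k := by
    have z : ∑ j, ∑ k, 2 * (u j k * v j k) = 0 := sum_eq_zero_of_antisymm fun j k => by
      rw [hu j k, hv j k]; ring
    rw [Finset.mul_sum, ← add_zero (∑ j, ∑ k, (u j k ^ 2 + v j k ^ 2)), ← z]
    simp only [Finset.mul_sum, ← Finset.sum_add_distrib, ← Finset.sum_sub_distrib]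
    refine Finset.sum_congr rfl fun j _ => Finset.sum_congr rfl fun k _ => ?_
    simp only [ht]
    ring
  rw [e1]
  linear_combination (e4.trans e5) / 3 + e6

/-- The algebraic identity behind the differential equation: `a`, `u`, `v` are the logarithmic
derivatives and `p`, `m`, `s` the values of `℘` at the corresponding arguments. -/
theorem inozemtsev_identity (g : Fin 4 → ℂ) (lam κ : ℂ) {a p : ι → Fin 4 → ℂ}
    {e : Fin 4 → Fin 4 → ℂ} {u v m s : ι → ι → ℂ}
    (hu : ∀ j k, u k j = -u j k) (hv : ∀ j k, v k j = v j k) (hm : ∀ j k, m k j = m j k)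
    (hs : ∀ j k, s k j = s j k)
    (hu0 : ∀ j, u j j = 0) (hv0 : ∀ j, v j j = 0) (hm0 : ∀ j, m j j = 0) (hs0 : ∀ j, s j j = 0)
    (h1 : ∀ j μ ν, μ ≠ ν → (a j μ - a j ν) ^ 2 = p j μ + p j ν + e μ ν)
    (h2 : ∀ ν j k, j ≠ k → (a j ν - a k ν - u j k) ^ 2 = p j ν + p k ν + m j k)
    (h3 : ∀ ν j k, j ≠ k → (a j ν + a k ν - v j k) ^ 2 = p j ν + p k ν + s j k)
    (h4 : ∀ j k l, j ≠ k → k ≠ l → j ≠ l →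
      (u j k + u k l - u j l) ^ 2 = m j k + m k l + m j l)
    (h5 : ∀ j k l, j ≠ k → k ≠ l → j ≠ l →
      (u j k + v k l - v j l) ^ 2 = m j k + s k l + s j l)
    {n A : ℂ} (hn : n = Fintype.card ι) (hA : A = 4 * lam * (n - 1) + 2 * absG g) :
    A / 2 * (∑ j, ∑ ν, g ν * (a j ν ^ 2 - p j ν - κ) +
        lam / 2 * (∑ j, ∑ k, (u j k ^ 2 + v j k ^ 2 - m j k - s j k) - 2 * (n * (n - 1)) * κ)) -
      (∑ j, (∑ ν, g ν * (-p j ν - κ) + lam * (∑ k, (-m j k - s j k) - 2 * (n - 1) * κ) +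
        (∑ ν, g ν * a j ν + lam * ∑ k, (u j k + v j k)) ^ 2)) +
      ∑ j, ∑ ν, g ν * (g ν - 1) * p j ν + lam * (lam - 1) * ∑ j, ∑ k, (m j k + s j k) -
      (A / 2 * n * (1 - lam * (n - 1) - absG g) * κ +
        n * ∑ μ : Fin 4, ∑ ν ∈ Finset.Ioi μ, g μ * g ν * e μ ν) = 0 := by
  have X1 : ∑ j, (∑ ν, g ν * a j ν) ^ 2 = absG g * ∑ j, ∑ ν, g ν * a j ν ^ 2 -
      absG g * ∑ j, ∑ ν, g ν * p j ν + ∑ j, ∑ ν, g ν ^ 2 * p j ν -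
      n * ∑ μ : Fin 4, ∑ ν ∈ Finset.Ioi μ, g μ * g ν * e μ ν := by
    rw [Finset.sum_congr rfl fun j _ => sq_sum_four g (a j) (p j) e (h1 j)]
    rw [Finset.sum_sub_distrib, Finset.sum_add_distrib, Finset.sum_sub_distrib,
      ← Finset.mul_sum, ← Finset.mul_sum, Finset.sum_const, Finset.card_univ, nsmul_eq_mul, hn]
  have X2 : ∑ j, (∑ ν, g ν * a j ν) * ∑ k, (u j k + v j k) =
      (n - 1) * (∑ j, ∑ ν, g ν * a j ν ^ 2 - ∑ j, ∑ ν, g ν * p j ν) +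
        absG g * (∑ j, ∑ k, (u j k ^ 2 + v j k ^ 2 - m j k - s j k)) / 4 := by
    have r : ∀ T : ι → ℂ, ∑ j, (∑ ν, g ν * a j ν) * T j = ∑ ν, g ν * ∑ j, a j ν * T j := by
      intro T
      simp only [Finset.sum_mul, Finset.mul_sum, mul_assoc]
      rw [Finset.sum_comm]
    rw [r, Finset.sum_congr rfl fun ν _ => by
      rw [sum_mul_pair hu hv hu0 hv0 hm0 hs0 (h2 ν) (h3 ν), ← hn]]
    rw [Finset.sum_comm (f := fun j ν => g ν * a j ν ^ 2),
      Finset.sum_comm (f := fun j ν => g ν * p j ν)]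
    simp only [← Finset.mul_sum, Fin.sum_univ_four, Finset.sum_sub_distrib, absG]
    ring
  have X3 := sum_sq_triple hu hv hm hs hu0 hv0 hm0 hs0 h4 h5
  rw [← hn] at X3
  have Y1 : ∑ j, ∑ ν, g ν * (a j ν ^ 2 - p j ν - κ) =
      ∑ j, ∑ ν, g ν * a j ν ^ 2 - ∑ j, ∑ ν, g ν * p j ν - n * (absG g * κ) := by
    simp only [mul_sub, Finset.sum_sub_distrib, ← Finset.sum_mul, Finset.sum_const,
      Finset.card_univ, nsmul_eq_mul, ← hn, absG, Fin.sum_univ_four]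
    ring
  have Y2 : ∑ j, ∑ ν, g ν * (-p j ν - κ) = -∑ j, ∑ ν, g ν * p j ν - n * (absG g * κ) := by
    simp only [mul_sub, mul_neg, Finset.sum_neg_distrib, Finset.sum_sub_distrib, ← Finset.sum_mul,
      Finset.sum_const, Finset.card_univ, nsmul_eq_mul, ← hn, absG, Fin.sum_univ_four]
    ring
  have Y3 : ∑ j, ∑ ν, g ν * (g ν - 1) * p j ν =
      ∑ j, ∑ ν, g ν ^ 2 * p j ν - ∑ j, ∑ ν, g ν * p j ν := by
    simp only [← Finset.sum_sub_distrib]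
    exact Finset.sum_congr rfl fun j _ => Finset.sum_congr rfl fun ν _ => by ring
  have Y4 : ∑ j, ∑ k, (u j k ^ 2 + v j k ^ 2 - m j k - s j k) =
      ∑ j, ∑ k, (u j k ^ 2 + v j k ^ 2) - ∑ j, ∑ k, (m j k + s j k) := by
    simp only [← Finset.sum_sub_distrib]
    exact Finset.sum_congr rfl fun j _ => Finset.sum_congr rfl fun k _ => by ring
  have Y5 : ∑ j, lam * (∑ k, (-m j k - s j k) - 2 * (n - 1) * κ) =
      -lam * ∑ j, ∑ k, (m j k + s j k) - 2 * lam * (n * (n - 1)) * κ := by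
    rw [← Finset.mul_sum, Finset.sum_sub_distrib, Finset.sum_const, Finset.card_univ,
      nsmul_eq_mul, ← hn]
    have : ∑ j, ∑ k, (-m j k - s j k) = -∑ j, ∑ k, (m j k + s j k) := by
      simp only [← Finset.sum_neg_distrib]
      exact Finset.sum_congr rfl fun j _ => Finset.sum_congr rfl fun k _ => by ring
    rw [this]
    ring
  have Y6 : ∑ j, (∑ ν, g ν * a j ν + lam * ∑ k, (u j k + v j k)) ^ 2 =
      ∑ j, (∑ ν, g ν * a j ν) ^ 2 +
        2 * lam * ∑ j, (∑ ν, g ν * a j ν) * ∑ k, (u j k + v j k) +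
        lam ^ 2 * ∑ j, (∑ k, (u j k + v j k)) ^ 2 := by
    rw [Finset.mul_sum, Finset.mul_sum, ← Finset.sum_add_distrib, ← Finset.sum_add_distrib]
    exact Finset.sum_congr rfl fun j _ => by ring
  -- The value of `A` is what makes the squares cancel: `g_ν a_jν²` occurs with `|g| + 2λ(n-1) =
  -- A/2`, and the pair sums with `λ²(n-1) + λ|g|/2 = λA/4`.
  rw [Finset.sum_add_distrib, Finset.sum_add_distrib, Y1, Y2, Y3, Y5, Y6, X1, X2, X3, Y4, hA]
  ring

end Algebra

/-! ### The logarithm of `Ψ_N` and its derivatives -/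

/-- A continuous branch of the logarithm of a differentiable function is differentiable. -/
theorem IsLogBranchOn.hasFDerivAt {E : Type*} [NormedAddCommGroup E] [NormedSpace ℂ E]
    {F l : E → ℂ} {U : Set E} (hl : IsLogBranchOn F l U) (hU : IsOpen U) {p : E} (hp : p ∈ U)
    {F' : E →L[ℂ] ℂ} (hF : HasFDerivAt F F' p) : HasFDerivAt l ((F p)⁻¹ • F') p := by
  have hFp : F p ≠ 0 := by rw [← hl.2 p hp]; exact Complex.exp_ne_zero _
  have hc : ContinuousAt l p := hl.1.continuousAt (hU.mem_nhds hp)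
  -- Near `p` the increment of `l` has imaginary part below `π` in modulus, so it is the principal
  -- logarithm of `F q / F p`.
  have hev : l =ᶠ[𝓝 p] fun q => l p + Complex.log (F q * (F p)⁻¹) := by
    have h1 : ∀ᶠ q in 𝓝 p, ‖l q - l p‖ < π := by
      have : Tendsto (fun q => ‖l q - l p‖) (𝓝 p) (𝓝 0) := by
        have := (hc.sub continuousAt_const).norm (f := fun q => l q - l p)
        simpa [ContinuousAt] using this
      exact this.eventually (gt_mem_nhds Real.pi_pos)
    filter_upwards [h1, hU.mem_nhds hp] with q hq hqU
    have him := abs_lt.mp ((Complex.abs_im_le_norm (l q - l p)).trans_lt hq)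
    rw [← hl.2 q hqU, ← hl.2 p hp, ← Complex.exp_neg, ← Complex.exp_add, ← sub_eq_add_neg,
      Complex.log_exp him.1 him.2.le]
    ring
  have hone : F p * (F p)⁻¹ = 1 := mul_inv_cancel₀ hFp
  have h := ((hF.mul_const (F p)⁻¹).clog (by rw [hone]; exact Complex.one_mem_slitPlane)).const_add
    (l p)
  refine (h.congr_of_eventuallyEq hev).congr_fderiv ?_
  rw [hone]
  simp

section

variable {N : ℕ} {ω₁ : ℂ} {U : Set ((Fin N → ℂ) × ℂ)}

theorem deriv_deriv_div_theta {β : ℂ} (hβ : 0 < (tau ω₁ β).im) (ν : Fin 4) {x : ℂ}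
    (hx : theta ω₁ (tau ω₁ β) ν x ≠ 0) :
    deriv (deriv (theta ω₁ (tau ω₁ β) ν)) x / theta ω₁ (tau ω₁ β) ν x =
      deriv (logDeriv (theta ω₁ (tau ω₁ β) ν)) x + logDeriv (theta ω₁ (tau ω₁ β) ν) x ^ 2 := by
  have h0 := (differentiable_theta (ω₁ := ω₁) hβ ν).analyticAt x
  have h := h0.deriv.differentiableAt.hasDerivAt.div h0.differentiableAt.hasDerivAt hx
  have e : deriv (logDeriv (theta ω₁ (tau ω₁ β) ν)) x = _ := h.deriv
  rw [e, logDeriv_apply]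
  field_simp
  ring

/-- The linear form `c` treats the arguments `x_j`, `x_j - x_k` and `x_j + x_k` at once. -/
theorem hasFDerivAt_logBranch_theta (hU : IsOpen U) {x : Fin N → ℂ} {β : ℂ} (hp : (x, β) ∈ U)
    (hβ : 0 < (tau ω₁ β).im) (c : (Fin N → ℂ) →L[ℂ] ℂ) (ν : Fin 4) {l : (Fin N → ℂ) × ℂ → ℂ}
    (hl : IsLogBranchOn (fun p => theta ω₁ (tau ω₁ p.2) ν (c p.1)) l U) :
    HasFDerivAt l (logDeriv (theta ω₁ (tau ω₁ β) ν) (c x) • (c ∘L ContinuousLinearMap.fst ℂ _ _) +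
      ((deriv (logDeriv (theta ω₁ (tau ω₁ β) ν)) (c x) +
        logDeriv (theta ω₁ (tau ω₁ β) ν) (c x) ^ 2) / 2) • ContinuousLinearMap.snd ℂ _ _)
      (x, β) := by
  have hne : theta ω₁ (tau ω₁ β) ν (c x) ≠ 0 := by
    have e : Complex.exp (l (x, β)) = theta ω₁ (tau ω₁ β) ν (c x) := hl.2 _ hp
    rw [← e]
    exact Complex.exp_ne_zero _
  have hc : HasFDerivAt (fun p : (Fin N → ℂ) × ℂ => c p.1)
      (c ∘L ContinuousLinearMap.fst ℂ (Fin N → ℂ) ℂ) (x, β) :=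
    (c ∘L ContinuousLinearMap.fst ℂ (Fin N → ℂ) ℂ).hasFDerivAt
  have hin : HasFDerivAt (fun p : (Fin N → ℂ) × ℂ => (c p.1, p.2))
      ((c ∘L ContinuousLinearMap.fst ℂ (Fin N → ℂ) ℂ).prod
        (ContinuousLinearMap.snd ℂ (Fin N → ℂ) ℂ)) (x, β) :=
    hc.prodMk hasFDerivAt_snd
  have hF := (hasFDerivAt_theta hβ ν (c x)).comp (x, β) hin
  refine (hl.hasFDerivAt hU hp hF).congr_fderiv ?_
  rw [← deriv_deriv_div_theta hβ ν hne, logDeriv_apply]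
  refine ContinuousLinearMap.ext fun v => ?_
  change (theta ω₁ (tau ω₁ β) ν (c x))⁻¹ * (deriv (theta ω₁ (tau ω₁ β) ν) (c x) * c v.1 +
    deriv (deriv (theta ω₁ (tau ω₁ β) ν)) (c x) / 2 * v.2) =
    deriv (theta ω₁ (tau ω₁ β) ν) (c x) / theta ω₁ (tau ω₁ β) ν (c x) * c v.1 +
    deriv (deriv (theta ω₁ (tau ω₁ β) ν)) (c x) / theta ω₁ (tau ω₁ β) ν (c x) / 2 * v.2
  ring

/-- Passes from pairs `j < k` to all ordered pairs, the form used in the algebraic identity. -/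
theorem sum_Ioi_eq_sum_ite {ι : Type*} [Fintype ι] [LinearOrder ι] [LocallyFiniteOrderTop ι]
    [LocallyFiniteOrderBot ι] {w W : ι → ι → ℂ} (h : ∀ i k, i < k → w i k = W i k + W k i) :
    ∑ i, ∑ k ∈ Finset.Ioi i, w i k = ∑ i, ∑ k, if i = k then 0 else W i k := by
  have h1 : ∑ i, ∑ k ∈ Finset.Ioi i, w i k = ∑ i, ∑ k ∈ Finset.Ioi i, (W k i + W i k) :=
    Finset.sum_congr rfl fun i _ => Finset.sum_congr rfl fun k hk => by
      rw [h i k (Finset.mem_Ioi.mp hk), add_comm]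
  rw [h1, Finset.sum_sum_Ioi_add_eq_sum_sum_off_diag (fun k i => W k i), Finset.sum_comm' (t' :=
    Finset.univ) (s' := fun k => {k}ᶜ) (by simp [eq_comm])]
  refine Finset.sum_congr rfl fun i _ => ?_
  rw [Finset.compl_eq_univ_sdiff, Finset.sum_ite, Finset.sum_const_zero, zero_add]
  refine Finset.sum_congr ?_ fun _ _ => rfl
  ext k
  simp [eq_comm]

theorem sum_ite_const {ι : Type*} [Fintype ι] [DecidableEq ι] (j : ι) (c : ℂ) :
    ∑ k, (if j = k then 0 else c) = ((Fintype.card ι : ℂ) - 1) * c := by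
  have h : ∀ k, (if j = k then 0 else c) = c - if j = k then c else 0 := fun k => by
    split_ifs <;> simp
  simp only [h, Finset.sum_sub_distrib, Finset.sum_ite_eq, Finset.mem_univ, if_true,
    Finset.sum_const, Finset.card_univ, nsmul_eq_mul]
  ring

/-- The exponent of `Ψ_N`. -/
def logPsi (g : Fin 4 → ℂ) (lam : ℂ) (l : Fin N → Fin 4 → (Fin N → ℂ) × ℂ → ℂ)
    (lm lp : Fin N → Fin N → (Fin N → ℂ) × ℂ → ℂ) (p : (Fin N → ℂ) × ℂ) : ℂ :=
  ∑ j : Fin N, ∑ ν : Fin 4, g ν * l j ν p +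
    ∑ j : Fin N, ∑ k ∈ Finset.Ioi j, (lam * lm j k p + lam * lp j k p)

theorem Psi_eq_exp (g : Fin 4 → ℂ) (lam : ℂ) (l : Fin N → Fin 4 → (Fin N → ℂ) × ℂ → ℂ)
    (lm lp : Fin N → Fin N → (Fin N → ℂ) × ℂ → ℂ) (p : (Fin N → ℂ) × ℂ) :
    Psi g lam l lm lp p = cexp (logPsi g lam l lm lp p) := by
  simp only [Psi, logPsi, Complex.exp_add, Complex.exp_sum]

/-- The logarithmic `x_j`-derivative of `Ψ_N`. -/
def logGrad (ω₁ β : ℂ) (g : Fin 4 → ℂ) (lam : ℂ) (j : Fin N) (y : Fin N → ℂ) : ℂ :=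
  ∑ ν, g ν * logDeriv (theta ω₁ (tau ω₁ β) ν) (y j) +
    lam * ∑ k, if j = k then 0 else logDeriv (theta ω₁ (tau ω₁ β) 0) (y j - y k) +
      logDeriv (theta ω₁ (tau ω₁ β) 0) (y j + y k)

/-- Half of `θ'' / θ`, which by the heat equation is the logarithmic `β`-derivative of `θ`. -/
def halfLaplace (ω₁ β : ℂ) (ν : Fin 4) (x : ℂ) : ℂ :=
  (deriv (logDeriv (theta ω₁ (tau ω₁ β) ν)) x + logDeriv (theta ω₁ (tau ω₁ β) ν) x ^ 2) / 2

/-- The logarithmic `β`-derivative of `Ψ_N`. -/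
def logDerivBeta (ω₁ β : ℂ) (g : Fin 4 → ℂ) (lam : ℂ) (y : Fin N → ℂ) : ℂ :=
  ∑ j, ∑ ν, g ν * halfLaplace ω₁ β ν (y j) +
    ∑ j, ∑ k ∈ Finset.Ioi j, (lam * halfLaplace ω₁ β 0 (y j - y k) +
      lam * halfLaplace ω₁ β 0 (y j + y k))

/-- Only the values of the total derivative on the coordinate directions matter, so it is left
existential. -/
theorem exists_hasFDerivAt_logPsi (hU : IsOpen U) (hτ : ∀ p ∈ U, 0 < (tau ω₁ p.2).im)
    (g : Fin 4 → ℂ) (lam : ℂ) {l : Fin N → Fin 4 → (Fin N → ℂ) × ℂ → ℂ}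
    {lm lp : Fin N → Fin N → (Fin N → ℂ) × ℂ → ℂ}
    (hl : ∀ j ν, IsLogBranchOn (fun p => theta ω₁ (tau ω₁ p.2) ν (p.1 j)) (l j ν) U)
    (hlm : ∀ j k, j < k →
      IsLogBranchOn (fun p => theta ω₁ (tau ω₁ p.2) 0 (p.1 j - p.1 k)) (lm j k) U)
    (hlp : ∀ j k, j < k →
      IsLogBranchOn (fun p => theta ω₁ (tau ω₁ p.2) 0 (p.1 j + p.1 k)) (lp j k) U)
    {y : Fin N → ℂ} {β : ℂ} (hp : (y, β) ∈ U) :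
    ∃ S' : (Fin N → ℂ) × ℂ →L[ℂ] ℂ, HasFDerivAt (logPsi g lam l lm lp) S' (y, β) ∧
      (∀ j, S' (Pi.single j 1, 0) = logGrad ω₁ β g lam j y) ∧
      S' (0, 1) = logDerivBeta ω₁ β g lam y := by
  have hβ := hτ _ hp
  let pr : Fin N → (Fin N → ℂ) →L[ℂ] ℂ := fun j => ContinuousLinearMap.proj j
  have d1 := fun j ν => (hasFDerivAt_logBranch_theta hU hp hβ (pr j) ν (hl j ν)).const_mul (g ν)
  have d2 := fun j k (h : j < k) =>
    (hasFDerivAt_logBranch_theta hU hp hβ (pr j - pr k) 0 (hlm j k h)).const_mul lam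
  have d3 := fun j k (h : j < k) =>
    (hasFDerivAt_logBranch_theta hU hp hβ (pr j + pr k) 0 (hlp j k h)).const_mul lam
  have hS := (HasFDerivAt.fun_sum (u := Finset.univ) fun j _ =>
    HasFDerivAt.fun_sum (u := Finset.univ) fun ν _ => d1 j ν).add
    (HasFDerivAt.fun_sum (u := Finset.univ) fun j _ =>
    HasFDerivAt.fun_sum (u := Finset.Ioi j) fun k hk =>
      (d2 j k (Finset.mem_Ioi.mp hk)).add (d3 j k (Finset.mem_Ioi.mp hk)))
  refine ⟨_, hS, fun j => ?_, ?_⟩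
  · simp only [add_apply, sum_apply,
      smul_apply, ContinuousLinearMap.comp_apply,
      ContinuousLinearMap.coe_fst', ContinuousLinearMap.coe_snd', smul_eq_mul, mul_zero, add_zero,
      pr, sub_apply, ContinuousLinearMap.proj_apply, logGrad]
    congr 1
    · rw [Finset.sum_eq_single j]
      · simp
      · intro b _ hb
        simp [hb]
      · simp
    -- As the logarithmic derivative of `θ₁` is odd, a pair contributes to its two variables by the
    -- same formula with the indices exchanged.
    · rw [sum_Ioi_eq_sum_ite (W := fun i k => lam * ((logDeriv (theta ω₁ (tau ω₁ β) 0) (y i - y k) +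
        logDeriv (theta ω₁ (tau ω₁ β) 0) (y i + y k)) * (Pi.single j (1 : ℂ) : Fin N → ℂ) i))]
      · rw [Finset.sum_eq_single j]
        · rw [Finset.mul_sum]
          refine Finset.sum_congr rfl fun k _ => ?_
          split_ifs <;> simp
        · intro b _ hb
          simp [hb]
        · simp
      · intro i k _
        rw [← neg_sub (y i) (y k), logDeriv_theta_neg hβ, add_comm (y k) (y i)]
        ring
  · simp only [add_apply, sum_apply,
      smul_apply, ContinuousLinearMap.comp_apply,
      ContinuousLinearMap.coe_fst', ContinuousLinearMap.coe_snd', smul_eq_mul, mul_zero, zero_add,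
      map_zero, pr, sub_apply, ContinuousLinearMap.proj_apply, logDerivBeta,
      halfLaplace, mul_one]

end

/-! ### Division by `Ψ_N`: the identity for logarithmic derivatives -/

section

variable {N : ℕ} {ω₁ : ℂ} {U : Set ((Fin N → ℂ) × ℂ)}

/-- The `x_j`-derivative of the logarithmic `x_j`-derivative of `Ψ_N`. -/
def logGrad' (ω₁ β : ℂ) (g : Fin 4 → ℂ) (lam : ℂ) (j : Fin N) (x : Fin N → ℂ) : ℂ :=
  ∑ ν, g ν * deriv (logDeriv (theta ω₁ (tau ω₁ β) ν)) (x j) +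
    lam * ∑ k, if j = k then 0 else deriv (logDeriv (theta ω₁ (tau ω₁ β) 0)) (x j - x k) +
      deriv (logDeriv (theta ω₁ (tau ω₁ β) 0)) (x j + x k)

theorem differentiableAt_logDeriv_theta {β : ℂ} (hβ : 0 < (tau ω₁ β).im) (ν : Fin 4) {x : ℂ}
    (hx : theta ω₁ (tau ω₁ β) ν x ≠ 0) :
    DifferentiableAt ℂ (logDeriv (theta ω₁ (tau ω₁ β) ν)) x := by
  have h1 := (differentiable_theta (ω₁ := ω₁) hβ ν).analyticAt x
  exact (h1.deriv.div h1 hx).differentiableAt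

theorem hasDerivAt_logGrad {β : ℂ} (hβ : 0 < (tau ω₁ β).im) (g : Fin 4 → ℂ) (lam : ℂ) (j : Fin N)
    {x : Fin N → ℂ} (h0 : ∀ ν, theta ω₁ (tau ω₁ β) ν (x j) ≠ 0)
    (hm : ∀ k, j ≠ k → theta ω₁ (tau ω₁ β) 0 (x j - x k) ≠ 0)
    (hp : ∀ k, j ≠ k → theta ω₁ (tau ω₁ β) 0 (x j + x k) ≠ 0) :
    HasDerivAt (fun z => logGrad ω₁ β g lam j (Function.update x j z))
      (logGrad' ω₁ β g lam j x) (x j) := by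
  have e : (fun z => logGrad ω₁ β g lam j (Function.update x j z)) = fun z =>
      ∑ ν, g ν * logDeriv (theta ω₁ (tau ω₁ β) ν) z +
        lam * ∑ k, if j = k then 0 else logDeriv (theta ω₁ (tau ω₁ β) 0) (z - x k) +
          logDeriv (theta ω₁ (tau ω₁ β) 0) (z + x k) := by
    funext z
    simp only [logGrad, Function.update_self]
    congr 2
    refine Finset.sum_congr rfl fun k _ => ?_
    split_ifs with hjk
    · rfl
    · rw [Function.update_of_ne (Ne.symm hjk)]
  rw [e]
  refine HasDerivAt.add (HasDerivAt.fun_sum fun ν _ =>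
    (differentiableAt_logDeriv_theta hβ ν (h0 ν)).hasDerivAt.const_mul _)
    (HasDerivAt.const_mul _ (HasDerivAt.fun_sum fun k _ => ?_))
  split_ifs with hjk
  · exact hasDerivAt_const _ _
  · exact ((differentiableAt_logDeriv_theta hβ 0 (hm k hjk)).hasDerivAt.comp_sub_const _ _).add
      ((differentiableAt_logDeriv_theta hβ 0 (hp k hjk)).hasDerivAt.comp_add_const _ _)

/-- The logarithmic derivatives of `Ψ_N` satisfy the differential equation. -/
theorem logDeriv_identity {β : ℂ} (hβ : 0 < (tau ω₁ β).im) (g : Fin 4 → ℂ) (lam : ℂ)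
    {x : Fin N → ℂ} (h0 : ∀ j ν, theta ω₁ (tau ω₁ β) ν (x j) ≠ 0)
    (hm : ∀ j k, j ≠ k → theta ω₁ (tau ω₁ β) 0 (x j - x k) ≠ 0)
    (hp : ∀ j k, j ≠ k → theta ω₁ (tau ω₁ β) 0 (x j + x k) ≠ 0) :
    constA N g lam * logDerivBeta ω₁ β g lam x +
      (∑ j, (-(logGrad' ω₁ β g lam j x + logGrad ω₁ β g lam j x ^ 2) +
        ∑ ν, g ν * (g ν - 1) * (periods ω₁ β hβ).weierstrassP
          (x j + halfPeriod (periods ω₁ β hβ) ν)) +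
      ∑ j, ∑ k ∈ Finset.Ioi j, 2 * lam * (lam - 1) *
        ((periods ω₁ β hβ).weierstrassP (x j - x k) +
          (periods ω₁ β hβ).weierstrassP (x j + x k))) -
      constC (periods ω₁ β hβ) N g lam = 0 := by
  set L := periods ω₁ β hβ with hL
  set κ := eta1 L / halfPeriod L 1 with hκ
  let a : Fin N → Fin 4 → ℂ := fun j ν => logDeriv (theta ω₁ (tau ω₁ β) ν) (x j)
  let p : Fin N → Fin 4 → ℂ := fun j ν => L.weierstrassP (x j + halfPeriod L ν)
  let e : Fin 4 → Fin 4 → ℂ := fun μ ν => L.weierstrassP (halfPeriod L μ - halfPeriod L ν)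
  -- The pair quantities are set to zero on the diagonal, so that sums may run over all ordered
  -- pairs.
  let u : Fin N → Fin N → ℂ := fun j k =>
    if j = k then 0 else logDeriv (theta ω₁ (tau ω₁ β) 0) (x j - x k)
  let v : Fin N → Fin N → ℂ := fun j k =>
    if j = k then 0 else logDeriv (theta ω₁ (tau ω₁ β) 0) (x j + x k)
  let m : Fin N → Fin N → ℂ := fun j k => if j = k then 0 else L.weierstrassP (x j - x k)
  let s : Fin N → Fin N → ℂ := fun j k => if j = k then 0 else L.weierstrassP (x j + x k)
  have hh0 : halfPeriod L 0 = 0 := rfl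
  have hd : ∀ ν y, theta ω₁ (tau ω₁ β) ν y ≠ 0 → deriv (logDeriv (theta ω₁ (tau ω₁ β) ν)) y =
      -L.weierstrassP (y + halfPeriod L ν) - κ := fun ν y hy => deriv_logDeriv_theta hβ ν hy
  have key := inozemtsev_identity (n := N) (A := constA N g lam) (a := a) (p := p) (e := e)
    (u := u) (v := v) (m := m) (s := s) g lam κ
    (fun j k => by
      by_cases hjk : j = k
      · simp [u, hjk]
      · simp only [u, if_neg hjk, if_neg (Ne.symm hjk)]
        rw [← neg_sub, logDeriv_theta_neg hβ])
    (fun j k => by simp only [v, eq_comm, add_comm])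
    (fun j k => by
      by_cases hjk : j = k
      · simp [m, hjk]
      · simp only [m, if_neg hjk, if_neg (Ne.symm hjk)]
        rw [← neg_sub, L.weierstrassP_neg])
    (fun j k => by simp only [s, eq_comm, add_comm])
    (fun j => if_pos rfl) (fun j => if_pos rfl) (fun j => if_pos rfl) (fun j => if_pos rfl)
    (fun j μ ν hμν => sq_logDeriv_theta_sub hβ hμν (h0 j μ) (h0 j ν))
    (fun ν j k hjk => by
      simp only [u, m, if_neg hjk]
      exact sq_logDeriv_theta_sub_sub hβ ν (h0 j ν) (h0 k ν) (hm j k hjk))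
    (fun ν j k hjk => by
      simp only [v, s, if_neg hjk]
      exact sq_logDeriv_theta_add_sub hβ ν (h0 j ν) (h0 k ν) (hp j k hjk))
    (fun j k l hjk hkl hjl => by
      simp only [u, m, if_neg hjk, if_neg hkl, if_neg hjl]
      have e1 : x j - x k + (x k - x l) = x j - x l := by ring
      have h := sq_logDeriv_theta_add_sub hβ 0 (hm j k hjk) (hm k l hkl)
        (by rw [e1]; exact hm j l hjl)
      rwa [e1, ← hL, hh0, add_zero, add_zero] at h)
    (fun j k l hjk hkl hjl => by
      simp only [u, v, m, s, if_neg hjk, if_neg hkl, if_neg hjl]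
      have e1 : x j - x k + (x k + x l) = x j + x l := by ring
      have h := sq_logDeriv_theta_add_sub hβ 0 (hm j k hjk) (hp k l hkl)
        (by rw [e1]; exact hp j l hjl)
      rwa [e1, ← hL, hh0, add_zero, add_zero] at h)
    (by simp) rfl
  have B : logDerivBeta ω₁ β g lam x = (1 / 2) * (∑ j, ∑ ν, g ν * (a j ν ^ 2 - p j ν - κ) +
        lam / 2 * (∑ j, ∑ k, (u j k ^ 2 + v j k ^ 2 - m j k - s j k) -
          2 * ((N : ℂ) * (N - 1)) * κ)) := by
    have B1 : ∑ j, ∑ ν, g ν * halfLaplace ω₁ β ν (x j) =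
        (1 / 2) * ∑ j, ∑ ν, g ν * (a j ν ^ 2 - p j ν - κ) := by
      simp only [Finset.mul_sum]
      refine Finset.sum_congr rfl fun j _ => Finset.sum_congr rfl fun ν _ => ?_
      simp only [halfLaplace, hd ν _ (h0 j ν), a, p]
      ring
    have B2 : ∑ j, ∑ k ∈ Finset.Ioi j, (lam * halfLaplace ω₁ β 0 (x j - x k) +
        lam * halfLaplace ω₁ β 0 (x j + x k)) =
        lam / 4 * (∑ j, ∑ k, (u j k ^ 2 + v j k ^ 2 - m j k - s j k) -
          2 * ((N : ℂ) * (N - 1)) * κ) := by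
      have hc : ∑ j : Fin N, ∑ k, (if j = k then 0 else 2 * κ) = 2 * ((N : ℂ) * (N - 1)) * κ := by
        simp only [sum_ite_const, Finset.sum_const, Finset.card_univ, Fintype.card_fin,
          nsmul_eq_mul]
        ring
      rw [sum_Ioi_eq_sum_ite (W := fun j k => lam / 2 * (halfLaplace ω₁ β 0 (x j - x k) +
        halfLaplace ω₁ β 0 (x j + x k))), ← hc]
      · simp only [← Finset.sum_sub_distrib, Finset.mul_sum]
        refine Finset.sum_congr rfl fun j _ => Finset.sum_congr rfl fun k _ => ?_
        by_cases hjk : j = k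
        · simp [hjk, u, v, m, s]
        · simp only [halfLaplace, hd 0 _ (hm j k hjk), hd 0 _ (hp j k hjk), u, v, m, s,
            if_neg hjk, hh0, add_zero]
          ring
      -- `θ''/θ` is even, so the term at `x_j - x_k` splits equally between the two orders of the
      -- pair.
      · intro j k hjk
        have hlap : halfLaplace ω₁ β 0 (x k - x j) = halfLaplace ω₁ β 0 (x j - x k) := by
          rw [halfLaplace, halfLaplace, hd 0 _ (hm j k hjk.ne), hd 0 _ (hm k j hjk.ne'), hh0,
            add_zero, add_zero, ← neg_sub (x j), logDeriv_theta_neg hβ, L.weierstrassP_neg, neg_sq]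
        rw [hlap, add_comm (x k)]
        ring
    rw [logDerivBeta, B1, B2]
    ring
  have G1 : ∀ j, logGrad ω₁ β g lam j x = ∑ ν, g ν * a j ν + lam * ∑ k, (u j k + v j k) := by
    intro j
    rw [logGrad]
    congr 2
    refine Finset.sum_congr rfl fun k _ => ?_
    by_cases hjk : j = k
    · simp [hjk, u, v]
    · simp only [u, v, if_neg hjk]
  have G2 : ∀ j, logGrad' ω₁ β g lam j x = ∑ ν, g ν * (-p j ν - κ) +
      lam * (∑ k, (-m j k - s j k) - 2 * ((N : ℂ) - 1) * κ) := by
    intro j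
    -- Each `k ≠ j` contributes `κ` twice, from `x_j - x_k` and from `x_j + x_k`.
    have hc : ∑ k : Fin N, (if j = k then 0 else 2 * κ) = 2 * ((N : ℂ) - 1) * κ := by
      simp only [sum_ite_const, Fintype.card_fin]
      ring
    rw [logGrad', ← hc, ← Finset.sum_sub_distrib]
    congr 1
    · refine Finset.sum_congr rfl fun ν _ => ?_
      rw [hd ν _ (h0 j ν)]
    · congr 1
      refine Finset.sum_congr rfl fun k _ => ?_
      by_cases hjk : j = k
      · simp [hjk, m, s]
      · simp only [hd 0 _ (hm j k hjk), hd 0 _ (hp j k hjk), m, s, if_neg hjk, hh0, add_zero]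
        ring
  have P1 : ∑ j, ∑ k ∈ Finset.Ioi j, 2 * lam * (lam - 1) *
        (L.weierstrassP (x j - x k) + L.weierstrassP (x j + x k)) =
      lam * (lam - 1) * ∑ j, ∑ k, (m j k + s j k) := by
    rw [sum_Ioi_eq_sum_ite (W := fun j k => lam * (lam - 1) *
        (L.weierstrassP (x j - x k) + L.weierstrassP (x j + x k)))]
    · simp only [Finset.mul_sum]
      refine Finset.sum_congr rfl fun j _ => Finset.sum_congr rfl fun k _ => ?_
      by_cases hjk : j = k
      · simp [hjk, m, s]
      · simp only [m, s, if_neg hjk]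
    · intro j k _
      rw [← neg_sub (x j) (x k), L.weierstrassP_neg, add_comm (x k)]
      ring
  have hC : constC L N g lam = constA N g lam / 2 * N * (1 - lam * ((N : ℂ) - 1) - absG g) * κ +
      N * ∑ μ : Fin 4, ∑ ν ∈ Finset.Ioi μ, g μ * g ν * e μ ν := by
    rw [constC, ← hκ, ← constc0_eq]
  rw [Finset.sum_add_distrib, P1, B, hC, Finset.sum_neg_distrib]
  simp only [G1, G2]
  linear_combination key

end

end Inozemtsev

end

/-! ### The differential equation for `Ψ_N` -/

theorem corollary1 (N : ℕ) (hN : 0 < N) (g : Fin 4 → ℂ) (lam : ℂ) (ω₁ : ℂ) (hω₁ : ω₁ ≠ 0)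
    (U : Set ((Fin N → ℂ) × ℂ)) (hU : IsOpen U)
    (hτ : ∀ p ∈ U, 0 < (Inozemtsev.tau ω₁ p.2).im)
    (l : Fin N → Fin 4 → (Fin N → ℂ) × ℂ → ℂ)
    (lm lp : Fin N → Fin N → (Fin N → ℂ) × ℂ → ℂ)
    (hl : ∀ j ν, Inozemtsev.IsLogBranchOn
      (fun p => Inozemtsev.theta ω₁ (Inozemtsev.tau ω₁ p.2) ν (p.1 j)) (l j ν) U)
    (hlm : ∀ j k, j < k → Inozemtsev.IsLogBranchOn
      (fun p => Inozemtsev.theta ω₁ (Inozemtsev.tau ω₁ p.2) 0 (p.1 j - p.1 k)) (lm j k) U)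
    (hlp : ∀ j k, j < k → Inozemtsev.IsLogBranchOn
      (fun p => Inozemtsev.theta ω₁ (Inozemtsev.tau ω₁ p.2) 0 (p.1 j + p.1 k)) (lp j k) U) :
    DifferentiableOn ℂ (Inozemtsev.Psi g lam l lm lp) U ∧
    ∀ (x : Fin N → ℂ) (β : ℂ) (hp : (x, β) ∈ U),
      Inozemtsev.constA N g lam * deriv (fun b : ℂ => Inozemtsev.Psi g lam l lm lp (x, b)) β +
        Inozemtsev.hamiltonian (Inozemtsev.periods ω₁ β (hτ (x, β) hp)) g lam
          (fun y => Inozemtsev.Psi g lam l lm lp (y, β)) x -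
        Inozemtsev.constC (Inozemtsev.periods ω₁ β (hτ (x, β) hp)) N g lam *
          Inozemtsev.Psi g lam l lm lp (x, β) = 0 := by
  have hPsi : Inozemtsev.Psi g lam l lm lp =
      fun p => Complex.exp (Inozemtsev.logPsi g lam l lm lp p) :=
    funext (Inozemtsev.Psi_eq_exp g lam l lm lp)
  have hexp : ∀ {a b : ℂ}, Complex.exp a = b → b ≠ 0 := fun h => h ▸ Complex.exp_ne_zero _
  have hS := fun (y : Fin N → ℂ) (β : ℂ) (hp : (y, β) ∈ U) =>
    Inozemtsev.exists_hasFDerivAt_logPsi hU hτ g lam hl hlm hlp hp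
  refine ⟨fun p hp => ?_, fun x β hp => ?_⟩
  · obtain ⟨S', hS', -, -⟩ := hS p.1 p.2 hp
    rw [hPsi]
    exact hS'.cexp.differentiableAt.differentiableWithinAt
  · have hβ : 0 < (Inozemtsev.tau ω₁ β).im := hτ (x, β) hp
    have hdβ : deriv (fun b : ℂ => Inozemtsev.Psi g lam l lm lp (x, b)) β =
        Inozemtsev.Psi g lam l lm lp (x, β) * Inozemtsev.logDerivBeta ω₁ β g lam x := by
      obtain ⟨S', hS', -, hS'b⟩ := hS x β hp
      have h := (hS'.cexp.comp_hasDerivAt β ((hasDerivAt_const β x).prodMk (hasDerivAt_id β))).deriv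
      rw [hPsi]
      refine h.trans ?_
      rw [← hS'b]
      rfl
    have hdx : ∀ (j : Fin N) (z : ℂ), (Function.update x j z, β) ∈ U →
        HasDerivAt (fun z => Inozemtsev.Psi g lam l lm lp (Function.update x j z, β))
          (Inozemtsev.Psi g lam l lm lp (Function.update x j z, β) *
            Inozemtsev.logGrad ω₁ β g lam j (Function.update x j z)) z := by
      intro j z hz
      obtain ⟨S', hS', hS'j, -⟩ := hS _ β hz
      have h := hS'.cexp.comp_hasDerivAt z
        ((hasDerivAt_update x j z).prodMk (hasDerivAt_const z β))
      rw [hPsi]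
      refine h.congr_deriv ?_
      rw [← hS'j]
      rfl
    have h0 : ∀ j ν, Inozemtsev.theta ω₁ (Inozemtsev.tau ω₁ β) ν (x j) ≠ 0 :=
      fun j ν => hexp ((hl j ν).2 (x, β) hp)
    -- Logarithms are given only for `j < k`; oddness of `θ₁` covers the other order.
    have hm : ∀ j k, j ≠ k → Inozemtsev.theta ω₁ (Inozemtsev.tau ω₁ β) 0 (x j - x k) ≠ 0 := by
      intro j k hjk
      rcases lt_or_gt_of_ne hjk with h | h
      · exact hexp ((hlm j k h).2 (x, β) hp)
      · rw [← neg_sub, Inozemtsev.theta_zero_neg hβ, neg_ne_zero]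
        exact hexp ((hlm k j h).2 (x, β) hp)
    have hpl : ∀ j k, j ≠ k → Inozemtsev.theta ω₁ (Inozemtsev.tau ω₁ β) 0 (x j + x k) ≠ 0 := by
      intro j k hjk
      rcases lt_or_gt_of_ne hjk with h | h
      · exact hexp ((hlp j k h).2 (x, β) hp)
      · rw [add_comm]
        exact hexp ((hlp k j h).2 (x, β) hp)
    have hdd : ∀ j, iteratedDeriv 2
        (fun z => Inozemtsev.Psi g lam l lm lp (Function.update x j z, β)) (x j) =
        Inozemtsev.Psi g lam l lm lp (x, β) * (Inozemtsev.logGrad' ω₁ β g lam j x +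
          Inozemtsev.logGrad ω₁ β g lam j x ^ 2) := by
      intro j
      have hc : Continuous fun z : ℂ => (Function.update x j z, β) :=
        (continuous_iff_continuousAt.mpr fun z =>
          (hasDerivAt_update x j z).continuousAt).prodMk continuous_const
      have hxU : (Function.update x j (x j), β) ∈ U := by rwa [Function.update_eq_self]
      -- As `U` is open, the formula for the first derivative holds on a neighbourhood and can be
      -- differentiated again.
      have hev : deriv (fun z => Inozemtsev.Psi g lam l lm lp (Function.update x j z, β))
          =ᶠ[nhds (x j)] fun z => Inozemtsev.Psi g lam l lm lp (Function.update x j z, β) *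
            Inozemtsev.logGrad ω₁ β g lam j (Function.update x j z) := by
        filter_upwards [hc.continuousAt.preimage_mem_nhds (hU.mem_nhds hxU)] with z hz
        exact (hdx j z hz).deriv
      rw [iteratedDeriv_succ, iteratedDeriv_one, hev.deriv_eq]
      have h := (hdx j (x j) hxU).mul
        (Inozemtsev.hasDerivAt_logGrad hβ g lam j (h0 j) (hm j) (hpl j))
      refine h.deriv.trans ?_
      rw [Function.update_eq_self]
      ring
    have key := Inozemtsev.logDeriv_identity hβ g lam h0 hm hpl
    rw [hdβ, Inozemtsev.hamiltonian]
    simp only [hdd]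
    have hsum : ∀ q : Fin N → ℂ, ∑ j, (-(Inozemtsev.Psi g lam l lm lp (x, β) *
        (Inozemtsev.logGrad' ω₁ β g lam j x + Inozemtsev.logGrad ω₁ β g lam j x ^ 2)) +
          q j * Inozemtsev.Psi g lam l lm lp (x, β)) =
        Inozemtsev.Psi g lam l lm lp (x, β) * ∑ j, (-(Inozemtsev.logGrad' ω₁ β g lam j x +
          Inozemtsev.logGrad ω₁ β g lam j x ^ 2) + q j) := by
      intro q
      rw [Finset.mul_sum]
      exact Finset.sum_congr rfl fun j _ => by ring
    rw [hsum]
    linear_combination Inozemtsev.Psi g lam l lm lp (x, β) * key
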